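/- Let $n,m,p\ge 0$ be integers, $T\ge 0$, and let $U\subseteq\mathbb R^m$ and $V\subseteq\mathbb R^p$ be non-empty compact sets. Let $f:\mathbb R^n\times U\times V\to\mathbb R^n$, $l:\mathbb R^n\to\mathbb R$ and $h:\mathbb R^n\to\mathbb R$ be bounded and Lipschitz continuous in $x$ (for $f$: uniformly in $(u,v)\in U\times V$), and let $f(x,\cdot,\cdot)$ be continuous on $U\times V$ for every $x$. For $t\in[0,T]$ let $\mathcal V_{[t,T]}$ and $\widetilde{\mathcal U}_{[t,T]}$ be the sets of Lebesgue measurable functions from $[t,T]$ to $V$ and to $U\times[0,1]$, respectively. Let $\widetilde\Gamma_{[t,T]}$ be the set of non-anticipative strategies, i.e. of the maps $\tilde\gamma:\mathcal V_{[t,T]}\to\widetilde{\mathcal U}_{[t,T]}$ such that, for all $s\in[t,T]$ and $v,\hat v\in\mathcal V_{[t,T]}$, if $v=\hat v$ a.e. on $[t,s]$ then $\tilde\gamma[v]=\tilde\gamma[\hat v]$ a.e. on $[t,s]$. For $x\in\mathbb R^n$, $\tilde u=(u,\bar u)\in\widetilde{\mathcal U}_{[t,T]}$ and $v\in\mathcal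 V_{[t,T]}$ let $\tilde\phi(\cdot,t,x,\tilde u,v)$ be the unique continuous solution on $[t,T]$ of the augmented system $$\xi(\tau)=x+\int_t^\tau \bar u(s)\,f(\xi(s),u(s),v(s))\,ds ,$$ and let the "reach at any time" value function $\widetilde V:\mathbb R^n\times[0,T]\to\mathbb R$ be $$\widetilde V(x,t)=\inf_{\tilde\gamma\in\widetilde\Gamma_{[t,T]}}\ \sup_{v\in\mathcal V_{[t,T]}}\ \max\Big\{\,l\big(\tilde\phi(T,t,x,\tilde\gamma[v],v)\big),\ \max_{\tau\in[t,T]}h\big(\tilde\phi(\tau,t,x,\tilde\gamma[v],v)\big)\Big\}.$$ Then $\widetilde V$ is the unique continuous viscosity solution on $\mathbb R^n\times[0,T]$ of the variational inequality $$\max\Big\{\,h(x)-\widetilde V(x,t),\ \frac{\partial\widetilde V}{\partial t}(x,t)+\min\Big\{0,\ \sup_{v\in V}\inf_{u\in U}\frac{\partial\widetilde V}{\partial x}(x,t)\,f(x,u,v)\Big\}\Big\}=0$$ with terminal condition $\widetilde V(x,T)=\max\{l(x),h(x)\}$ for all $x\in\mathbb R^n$. Here a continuous function $\Phi:\mathbb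 R^n\times[0,T]\to\mathbb R$ is a viscosity solution of the variational inequality if for every $C^\infty$ function $W:\mathbb R^n\times(0,T)\to\mathbb R$ and every $(x_0,t_0)\in\mathbb R^n\times(0,T)$ the quantity $$\max\Big\{h(x_0)-\Phi(x_0,t_0),\ \frac{\partial W}{\partial t}(x_0,t_0)+\min\Big\{0,\ \sup_{v\in V}\inf_{u\in U}\frac{\partial W}{\partial x}(x_0,t_0)\,f(x_0,u,v)\Big\}\Big\}$$ is $\ge 0$ if $\Phi-W$ has a local maximum at $(x_0,t_0)$, and is $\le 0$ if $\Phi-W$ has a local minimum at $(x_0,t_0)$. -/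

import Mathlib

open Set MeasureTheory
open scoped ContDiff

namespace ReachAvoid

/-- Admissible inputs on `[t, t']`: Lebesgue measurable functions from `[t, t']` to `S`.
The values of such a function outside `[t, t']` are irrelevant. (For Lebesgue measure,
`AEMeasurable` is Lebesgue measurability, i.e. measurability for the completed σ-algebra.) -/
def Inputs {A : Type*} [MeasurableSpace A] (S : Set A) (t t' : ℝ) : Set (ℝ → A) :=
  {u | AEMeasurable u (volume.restrict (Icc t t')) ∧ ∀ τ ∈ Icc t t', u τ ∈ S}

/-- `γ` is a non-anticipative strategy on `[t, T]`: inputs of the second player that agree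
a.e. on `[t, s]` are answered by inputs that agree a.e. on `[t, s]`. -/
def NonAnticipative {A B : Type*} [MeasurableSpace A] [MeasurableSpace B]
    {U : Set A} {V : Set B} {t T : ℝ} (γ : Inputs V t T → Inputs U t T) : Prop :=
  ∀ s ∈ Icc t T, ∀ v v' : Inputs V t T,
    (∀ᵐ τ ∂(volume.restrict (Icc t s)), v.1 τ = v'.1 τ) →
      ∀ᵐ τ ∂(volume.restrict (Icc t s)), (γ v).1 τ = (γ v').1 τ

/-- The class of non-anticipative strategies on `[t, T]`. -/
def Strategies {A B : Type*} [MeasurableSpace A] [MeasurableSpace B]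
    (U : Set A) (V : Set B) (t T : ℝ) : Set (Inputs V t T → Inputs U t T) :=
  {γ | NonAnticipative γ}

/-- `ξ` is a (Carathéodory) solution on `[t, T]` of `ξ' = f(ξ, u, v)`, `ξ(t) = x`. -/
def IsTrajectory {n : ℕ} {A B : Type*}
    (f : EuclideanSpace ℝ (Fin n) → A → B → EuclideanSpace ℝ (Fin n)) (t T : ℝ)
    (x : EuclideanSpace ℝ (Fin n)) (u : ℝ → A) (v : ℝ → B)
    (ξ : ℝ → EuclideanSpace ℝ (Fin n)) : Prop :=
  ContinuousOn ξ (Icc t T) ∧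
  IntervalIntegrable (fun s => f (ξ s) (u s) (v s)) volume t T ∧
  ∀ τ ∈ Icc t T, ξ τ = x + ∫ s in t..τ, f (ξ s) (u s) (v s)

open Classical in
/-- The solution `τ ↦ φ(τ, t, x, u(·), v(·))` of the controlled system on `[t, T]`. When `f` is
bounded, Lipschitz in the state and continuous in the inputs, and `u`, `v` are admissible, a
solution exists and is unique on `[t, T]`, so that neither the choice nor the default matters. -/
noncomputable def trajectory {n : ℕ} {A B : Type*}
    (f : EuclideanSpace ℝ (Fin n) → A → B → EuclideanSpace ℝ (Fin n)) (t T : ℝ)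
    (x : EuclideanSpace ℝ (Fin n)) (u : ℝ → A) (v : ℝ → B) :
    ℝ → EuclideanSpace ℝ (Fin n) :=
  if H : ∃ ξ, IsTrajectory f t T x u v ξ then H.choose else fun _ => x

/-- The payoff `max { l(ξ(T)), max_{τ ∈ [t, T]} h(ξ(τ)) }` of a path `ξ`. -/
noncomputable def payoff {n : ℕ} (l h : EuclideanSpace ℝ (Fin n) → ℝ) (t T : ℝ)
    (ξ : ℝ → EuclideanSpace ℝ (Fin n)) : ℝ :=
  max (l (ξ T)) (⨆ τ : Icc t T, h (ξ τ))

/-- The value function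
`V(x, t) = inf_γ sup_v max { l(φ(T, t, x, γ[v], v)), max_{τ ∈ [t, T]} h(φ(τ, t, x, γ[v], v)) }`
of the game with dynamics `f`, where `γ` ranges over the non-anticipative strategies and `v`
over the inputs of the second player. -/
noncomputable def value {n : ℕ} {A B : Type*} [MeasurableSpace A] [MeasurableSpace B]
    (f : EuclideanSpace ℝ (Fin n) → A → B → EuclideanSpace ℝ (Fin n))
    (U : Set A) (V : Set B) (l h : EuclideanSpace ℝ (Fin n) → ℝ) (T : ℝ)
    (z : EuclideanSpace ℝ (Fin n) × ℝ) : ℝ :=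
  ⨅ γ : Strategies U V z.2 T, ⨆ v : Inputs V z.2 T,
    payoff l h z.2 T (trajectory f z.2 T z.1 (γ.1 v).1 v.1)

/-- The augmented dynamics `f̃(x, (u, ū), v) = ū f(x, u, v)`. -/
def augmented {n : ℕ} {A B : Type*}
    (f : EuclideanSpace ℝ (Fin n) → A → B → EuclideanSpace ℝ (Fin n)) :
    EuclideanSpace ℝ (Fin n) → A × ℝ → B → EuclideanSpace ℝ (Fin n) :=
  fun x a v => a.2 • f x a.1 v

/-- The "reach at any time" value function `Ṽ`: the value function of the augmented dynamics,
the first player's input taking values in `U × [0, 1]`. -/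
noncomputable def reachValue {n : ℕ} {A B : Type*} [MeasurableSpace A] [MeasurableSpace B]
    (f : EuclideanSpace ℝ (Fin n) → A → B → EuclideanSpace ℝ (Fin n))
    (U : Set A) (V : Set B) (l h : EuclideanSpace ℝ (Fin n) → ℝ) (T : ℝ) :
    EuclideanSpace ℝ (Fin n) × ℝ → ℝ :=
  value (augmented f) (U ×ˢ Icc (0 : ℝ) 1) V l h T

/-- The Hamiltonian `H(x, p) = sup_{v ∈ V} inf_{u ∈ U} pᵀ f(x, u, v)`. -/
noncomputable def hamiltonian {n : ℕ} {A B : Type*}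
    (f : EuclideanSpace ℝ (Fin n) → A → B → EuclideanSpace ℝ (Fin n))
    (U : Set A) (V : Set B) (x p : EuclideanSpace ℝ (Fin n)) : ℝ :=
  ⨆ v : V, ⨅ u : U, inner ℝ p (f x u v)

/-- `Φ : ℝⁿ × [0, T] → ℝ` is a (continuous) viscosity solution of the variational inequality
`max { h(x) - Φ(x, t), Φ_t(x, t) + G(x, Φ_x(x, t)) } = 0` (a terminal value problem).
The values of `Φ` outside `ℝⁿ × [0, T]` are irrelevant. -/
def IsViscositySolution {n : ℕ}
    (G : EuclideanSpace ℝ (Fin n) → EuclideanSpace ℝ (Fin n) → ℝ)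
    (h : EuclideanSpace ℝ (Fin n) → ℝ) (T : ℝ)
    (Φ : EuclideanSpace ℝ (Fin n) × ℝ → ℝ) : Prop :=
  ContinuousOn Φ (univ ×ˢ Icc 0 T) ∧
  ∀ W : EuclideanSpace ℝ (Fin n) × ℝ → ℝ, ContDiffOn ℝ ∞ W (univ ×ˢ Ioo 0 T) →
    ∀ x₀ : EuclideanSpace ℝ (Fin n), ∀ t₀ ∈ Ioo 0 T,
      (IsLocalMax (fun z => Φ z - W z) (x₀, t₀) →
        0 ≤ max (h x₀ - Φ (x₀, t₀))
          (deriv (fun t => W (x₀, t)) t₀ + G x₀ (gradient (fun x => W (x, t₀)) x₀))) ∧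
      (IsLocalMin (fun z => Φ z - W z) (x₀, t₀) →
        max (h x₀ - Φ (x₀, t₀))
          (deriv (fun t => W (x₀, t)) t₀ + G x₀ (gradient (fun x => W (x, t₀)) x₀)) ≤ 0)

end ReachAvoid

/-!
Freezing the state (multiplier `0`) turns the Hamiltonian `H` of the original system into
`min 0 H` for the augmented system (`RegularDynamics.hamiltonian_augmented`), so it suffices to
show, for arbitrary bounded Lipschitz dynamics `f` with compact control sets, that the value
function is the unique viscosity solution of `max {h - V, V_t + H(x, V_x)} = 0`.

*Existence.* Trajectories exist, are unique and depend Lipschitz continuously on the initial state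
by a contraction argument in a weighted norm. Concatenating inputs and strategies gives the two
halves of the dynamic programming principle (`value_le_of_strategy`,
`exists_strategy_forall_value_le`); both are stated as bounds by a constant `c`, which avoids
writing down the inf-sup over a part of the horizon. They yield the continuity of the value and,
over short times, the viscosity inequalities (`isViscositySolution_value`): where the inequality
for a local maximum fails, every `v ∈ V` has an answer `u ∈ U` that makes the test function
decrease, and a measurable selection of such answers is a non-anticipative strategy that lowers the
value too much; where the inequality for a local minimum fails, one constant input of the second
player raises it too much.

*Uniqueness.* Two solutions are compared by doubling the variables
(`IsViscositySolution.le_of_mem_Ioo`). No growth condition on the solutions is available, but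
since `H` is `C`-Lipschitz in the momentum, a smooth barrier of the form
`exp (lam * (√(1 + |x - x₀|²) - C t - 2))` is a supersolution of the linearized problem; it is small
at the point of interest and as large as desired on the side of a compact cylinder, where it
prevents the maximum from being attained. A second exponential keeps the maximum away from time `0`
and makes the inequality strict.
-/

namespace ReachAvoid

set_option linter.unusedSectionVars false

open Filter Topology

/-! ### Trajectories of the controlled system -/

section Basic

variable {n : ℕ} {A B : Type*} {f : EuclideanSpace ℝ (Fin n) → A → B → EuclideanSpace ℝ (Fin n)}
  {t T : ℝ} {u : ℝ → A} {v : ℝ → B}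

lemma IsTrajectory.apply_left {x : EuclideanSpace ℝ (Fin n)} {ξ : ℝ → EuclideanSpace ℝ (Fin n)}
    (hξ : IsTrajectory f t T x u v ξ) (htT : t ≤ T) : ξ t = x := by
  simpa using hξ.2.2 t ⟨le_rfl, htT⟩

lemma IsTrajectory.mono {x : EuclideanSpace ℝ (Fin n)} {ξ : ℝ → EuclideanSpace ℝ (Fin n)}
    (hξ : IsTrajectory f t T x u v ξ) {t' : ℝ} (ht' : t' ∈ Icc t T) :
    IsTrajectory f t t' x u v ξ := by
  refine ⟨hξ.1.mono (Icc_subset_Icc_right ht'.2), hξ.2.1.mono_set ?_,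
    fun τ hτ => hξ.2.2 τ ⟨hτ.1, hτ.2.trans ht'.2⟩⟩
  rw [uIcc_of_le ht'.1, uIcc_of_le (ht'.1.trans ht'.2)]
  exact Icc_subset_Icc_right ht'.2

lemma IsTrajectory.sub_eq {x : EuclideanSpace ℝ (Fin n)} {ξ : ℝ → EuclideanSpace ℝ (Fin n)}
    (hξ : IsTrajectory f t T x u v ξ) {a b : ℝ} (ha : a ∈ Icc t T) (hb : b ∈ Icc t T) :
    ξ b - ξ a = ∫ s in a..b, f (ξ s) (u s) (v s) := by
  have hI : ∀ τ ∈ Icc t T, IntervalIntegrable (fun s => f (ξ s) (u s) (v s)) volume t τ := by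
    intro τ hτ
    refine hξ.2.1.mono_set ?_
    rw [uIcc_of_le hτ.1, uIcc_of_le (hτ.1.trans hτ.2)]
    exact Icc_subset_Icc_right hτ.2
  rw [hξ.2.2 a ha, hξ.2.2 b hb, add_sub_add_left_eq_sub,
    intervalIntegral.integral_interval_sub_left (hI b hb) (hI a ha)]

lemma IsTrajectory.tail {x : EuclideanSpace ℝ (Fin n)} {ξ : ℝ → EuclideanSpace ℝ (Fin n)}
    (hξ : IsTrajectory f t T x u v ξ) {t' : ℝ} (ht' : t' ∈ Icc t T) :
    IsTrajectory f t' T (ξ t') u v ξ := by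
  refine ⟨hξ.1.mono (Icc_subset_Icc_left ht'.1), hξ.2.1.mono_set ?_, fun τ hτ => ?_⟩
  · rw [uIcc_of_le ht'.2, uIcc_of_le (ht'.1.trans ht'.2)]
    exact Icc_subset_Icc_left ht'.1
  · rw [← hξ.sub_eq ht' ⟨ht'.1.trans hτ.1, hτ.2⟩, add_sub_cancel]

lemma IsTrajectory.congr {x : EuclideanSpace ℝ (Fin n)} {ξ : ℝ → EuclideanSpace ℝ (Fin n)}
    (hξ : IsTrajectory f t T x u v ξ) {u' : ℝ → A} {v' : ℝ → B} (htT : t ≤ T)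
    (hu : ∀ᵐ τ ∂(volume.restrict (Icc t T)), u τ = u' τ)
    (hv : ∀ᵐ τ ∂(volume.restrict (Icc t T)), v τ = v' τ) :
    IsTrajectory f t T x u' v' ξ := by
  have h : ∀ τ ∈ Icc t T, (fun s => f (ξ s) (u s) (v s)) =ᵐ[volume.restrict (uIoc t τ)]
      fun s => f (ξ s) (u' s) (v' s) := by
    intro τ hτ
    refine ae_restrict_of_ae_restrict_of_subset (s := uIoc t τ) (t := Icc t T) ?_ ?_
    · rw [uIoc_of_le hτ.1]
      exact Ioc_subset_Icc_self.trans (Icc_subset_Icc_right hτ.2)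
    · filter_upwards [hu, hv] with s h1 h2
      rw [h1, h2]
  refine ⟨hξ.1, hξ.2.1.congr_ae (h T ⟨htT, le_rfl⟩), fun τ hτ => ?_⟩
  rw [hξ.2.2 τ hτ, intervalIntegral.integral_congr_ae_restrict (h τ hτ)]

end Basic

/-- The standing assumptions on a game: the control sets are non-empty and compact, and on them
the dynamics are bounded by `C`, `K`-Lipschitz in the state, and continuous in the controls. -/
structure RegularDynamics {n : ℕ} {A B : Type*} [TopologicalSpace A] [TopologicalSpace B]
    (f : EuclideanSpace ℝ (Fin n) → A → B → EuclideanSpace ℝ (Fin n))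
    (U : Set A) (V : Set B) (C K : ℝ) : Prop where
  isCompact_left : IsCompact U
  nonempty_left : U.Nonempty
  isCompact_right : IsCompact V
  nonempty_right : V.Nonempty
  bound_nonneg : 0 ≤ C
  lip_nonneg : 0 ≤ K
  bound : ∀ x, ∀ u ∈ U, ∀ v ∈ V, ‖f x u v‖ ≤ C
  lip : ∀ x y, ∀ u ∈ U, ∀ v ∈ V, ‖f x u v - f y u v‖ ≤ K * ‖x - y‖
  cont : ∀ x, ContinuousOn (fun w : A × B => f x w.1 w.2) (U ×ˢ V)

section Regular

variable {n : ℕ} {A B : Type*}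
  [TopologicalSpace A] [SecondCountableTopology A] [T2Space A] [MeasurableSpace A] [BorelSpace A]
  [TopologicalSpace B] [SecondCountableTopology B] [T2Space B] [MeasurableSpace B] [BorelSpace B]
  {f : EuclideanSpace ℝ (Fin n) → A → B → EuclideanSpace ℝ (Fin n)}
  {U : Set A} {V : Set B} {C K t T : ℝ} {u : ℝ → A} {v : ℝ → B}

lemma RegularDynamics.continuousOn (hf : RegularDynamics f U V C K) :
    ContinuousOn (fun w : EuclideanSpace ℝ (Fin n) × (A × B) => f w.1 w.2.1 w.2.2)
      (univ ×ˢ (U ×ˢ V)) := by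
  refine continuousOn_prod_of_continuousOn_lipschitzOnWith _ (Real.toNNReal K)
    (fun x _ => hf.cont x) ?_
  rintro ⟨a, b⟩ ⟨ha, hb⟩
  refine LipschitzOnWith.of_dist_le_mul fun x _ y _ => ?_
  rw [dist_eq_norm, dist_eq_norm, Real.coe_toNNReal _ hf.lip_nonneg]
  exact hf.lip x y a ha b hb

lemma RegularDynamics.aestronglyMeasurable (hf : RegularDynamics f U V C K)
    (hu : u ∈ Inputs U t T) (hv : v ∈ Inputs V t T) {ξ : ℝ → EuclideanSpace ℝ (Fin n)}
    (hξ : ContinuousOn ξ (Icc t T)) :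
    AEStronglyMeasurable (fun s => f (ξ s) (u s) (v s)) (volume.restrict (Icc t T)) := by
  classical
  have hS : MeasurableSet ((univ : Set (EuclideanSpace ℝ (Fin n))) ×ˢ (U ×ˢ V)) :=
    MeasurableSet.univ.prod
      (hf.isCompact_left.measurableSet.prod hf.isCompact_right.measurableSet)
  have hg := hf.continuousOn.measurable_piecewise
    (g := fun _ => (0 : EuclideanSpace ℝ (Fin n))) continuousOn_const hS
  have hw : AEMeasurable (fun s => (ξ s, (u s, v s))) (volume.restrict (Icc t T)) :=
    (hξ.aemeasurable measurableSet_Icc).prodMk (hu.1.prodMk hv.1)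
  refine (AEMeasurable.congr (hg.comp_aemeasurable hw) ?_).aestronglyMeasurable
  filter_upwards [ae_restrict_mem measurableSet_Icc] with s hs
  exact piecewise_eq_of_mem _ _ _ ⟨mem_univ _, hu.2 s hs, hv.2 s hs⟩

lemma RegularDynamics.integrableOn (hf : RegularDynamics f U V C K)
    (hu : u ∈ Inputs U t T) (hv : v ∈ Inputs V t T) {ξ : ℝ → EuclideanSpace ℝ (Fin n)}
    (hξ : ContinuousOn ξ (Icc t T)) :
    IntegrableOn (fun s => f (ξ s) (u s) (v s)) (Icc t T) := by
  refine ⟨hf.aestronglyMeasurable hu hv hξ, .of_bounded (C := C) ?_⟩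
  filter_upwards [ae_restrict_mem measurableSet_Icc] with s hs
  exact hf.bound _ _ (hu.2 s hs) _ (hv.2 s hs)

lemma RegularDynamics.intervalIntegrable (hf : RegularDynamics f U V C K)
    (hu : u ∈ Inputs U t T) (hv : v ∈ Inputs V t T) {ξ : ℝ → EuclideanSpace ℝ (Fin n)}
    (hξ : ContinuousOn ξ (Icc t T)) {a b : ℝ} (ha : a ∈ Icc t T) (hb : b ∈ Icc t T) :
    IntervalIntegrable (fun s => f (ξ s) (u s) (v s)) volume a b := by
  rw [intervalIntegrable_iff]
  refine (hf.integrableOn hu hv hξ).mono_set (uIoc_subset_uIcc.trans ?_)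
  exact uIcc_subset_Icc ha hb

/-- In the norm weighted by `exp (-(2 * K + 1) s)`, the integral operator of the system is a
contraction by the factor `1 / 2`. -/
lemma RegularDynamics.norm_integral_sub_le (hf : RegularDynamics f U V C K)
    (hu : u ∈ Inputs U t T) (hv : v ∈ Inputs V t T) {ξ η : ℝ → EuclideanSpace ℝ (Fin n)}
    (hξ : ContinuousOn ξ (Icc t T)) (hη : ContinuousOn η (Icc t T)) {M : ℝ} (hM : 0 ≤ M)
    (hle : ∀ s ∈ Icc t T, ‖ξ s - η s‖ ≤ M * Real.exp ((2 * K + 1) * s))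
    {τ : ℝ} (hτ : τ ∈ Icc t T) :
    ‖(∫ s in t..τ, f (ξ s) (u s) (v s)) - ∫ s in t..τ, f (η s) (u s) (v s)‖ ≤
      M / 2 * Real.exp ((2 * K + 1) * τ) := by
  have hK := hf.lip_nonneg
  have ht : t ∈ Icc t T := ⟨le_rfl, hτ.1.trans hτ.2⟩
  have hL : 2 * K + 1 ≠ 0 := by positivity
  rw [← intervalIntegral.integral_sub (hf.intervalIntegrable hu hv hξ ht hτ)
    (hf.intervalIntegrable hu hv hη ht hτ)]
  have h1 := intervalIntegral.norm_integral_le_of_norm_le (μ := volume) hτ.1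
    (f := fun s => f (ξ s) (u s) (v s) - f (η s) (u s) (v s))
    (g := fun s => K * M * Real.exp ((2 * K + 1) * s)) (Filter.Eventually.of_forall ?_)
    (Continuous.intervalIntegrable (by fun_prop) _ _)
  · refine h1.trans ?_
    rw [intervalIntegral.integral_const_mul,
      intervalIntegral.integral_comp_mul_left (fun s => Real.exp s) hL, integral_exp, smul_eq_mul]
    have h2 := Real.exp_pos ((2 * K + 1) * t)
    have h3 := Real.exp_pos ((2 * K + 1) * τ)
    have h4 : K * (2 * K + 1)⁻¹ ≤ 1 / 2 := by
      rw [← div_eq_mul_inv, div_le_iff₀ (by positivity)]; linarith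
    calc K * M * ((2 * K + 1)⁻¹ * (Real.exp ((2 * K + 1) * τ) - Real.exp ((2 * K + 1) * t)))
        ≤ K * M * ((2 * K + 1)⁻¹ * Real.exp ((2 * K + 1) * τ)) := by gcongr; linarith
      _ = (K * (2 * K + 1)⁻¹) * (M * Real.exp ((2 * K + 1) * τ)) := by ring
      _ ≤ 1 / 2 * (M * Real.exp ((2 * K + 1) * τ)) := by gcongr
      _ = _ := by ring
  · intro s hs
    have hs' : s ∈ Icc t T := ⟨hs.1.le, hs.2.trans hτ.2⟩
    calc _ ≤ K * ‖ξ s - η s‖ := hf.lip _ _ _ (hu.2 s hs') _ (hv.2 s hs')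
      _ ≤ K * (M * Real.exp ((2 * K + 1) * s)) := by gcongr; exact hle s hs'
      _ = _ := by ring

lemma IsTrajectory.norm_sub_le (hf : RegularDynamics f U V C K)
    (hu : u ∈ Inputs U t T) (hv : v ∈ Inputs V t T)
    {x y : EuclideanSpace ℝ (Fin n)} {ξ η : ℝ → EuclideanSpace ℝ (Fin n)}
    (hξ : IsTrajectory f t T x u v ξ) (hη : IsTrajectory f t T y u v η)
    {τ : ℝ} (hτ : τ ∈ Icc t T) :
    ‖ξ τ - η τ‖ ≤ 2 * Real.exp ((2 * K + 1) * (τ - t)) * ‖x - y‖ := by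
  have hK := hf.lip_nonneg
  have htT : t ≤ T := hτ.1.trans hτ.2
  set w : ℝ → ℝ := fun s => ‖ξ s - η s‖ * Real.exp (-((2 * K + 1) * s)) with hw
  have hwc : ContinuousOn w (Icc t T) :=
    ((hξ.1.sub hη.1).norm).mul (by fun_prop)
  obtain ⟨s₀, hs₀, hmax⟩ := isCompact_Icc.exists_isMaxOn (nonempty_Icc.2 htT) hwc
  have key : ∀ s ∈ Icc t T, ‖ξ s - η s‖ ≤ w s₀ * Real.exp ((2 * K + 1) * s) := by
    intro s hs
    have h1 : w s ≤ w s₀ := hmax hs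
    calc ‖ξ s - η s‖ = w s * Real.exp ((2 * K + 1) * s) := by
          rw [hw, mul_assoc, ← Real.exp_add]; simp
      _ ≤ _ := by gcongr
  have hw0 : 0 ≤ w s₀ := by positivity
  have h1 := hf.norm_integral_sub_le hu hv hξ.1 hη.1 hw0 key hs₀
  have h2 : ‖ξ s₀ - η s₀‖ ≤ ‖x - y‖ + w s₀ / 2 * Real.exp ((2 * K + 1) * s₀) := by
    rw [hξ.2.2 s₀ hs₀, hη.2.2 s₀ hs₀, add_sub_add_comm]
    exact (norm_add_le _ _).trans (by gcongr)
  have h3 : w s₀ ≤ ‖x - y‖ * Real.exp (-((2 * K + 1) * s₀)) + w s₀ / 2 := by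
    calc w s₀ ≤ (‖x - y‖ + w s₀ / 2 * Real.exp ((2 * K + 1) * s₀)) *
          Real.exp (-((2 * K + 1) * s₀)) := by
          exact mul_le_mul_of_nonneg_right h2 (Real.exp_pos _).le
      _ = ‖x - y‖ * Real.exp (-((2 * K + 1) * s₀)) + w s₀ / 2 := by
          rw [add_mul, mul_assoc (w s₀ / 2), ← Real.exp_add]; simp
  have h4 : Real.exp (-((2 * K + 1) * s₀)) ≤ Real.exp (-((2 * K + 1) * t)) := by
    have := hs₀.1
    gcongr
  have h5 : w s₀ ≤ 2 * (‖x - y‖ * Real.exp (-((2 * K + 1) * t))) := by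
    have := mul_le_mul_of_nonneg_left h4 (norm_nonneg (x - y))
    linarith
  calc ‖ξ τ - η τ‖ ≤ w s₀ * Real.exp ((2 * K + 1) * τ) := key τ hτ
    _ ≤ 2 * (‖x - y‖ * Real.exp (-((2 * K + 1) * t))) * Real.exp ((2 * K + 1) * τ) := by gcongr
    _ = 2 * (Real.exp ((2 * K + 1) * τ) * Real.exp (-((2 * K + 1) * t))) * ‖x - y‖ := by ring
    _ = _ := by rw [← Real.exp_add]; congr 3; ring

lemma IsTrajectory.eqOn (hf : RegularDynamics f U V C K)
    (hu : u ∈ Inputs U t T) (hv : v ∈ Inputs V t T)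
    {x : EuclideanSpace ℝ (Fin n)} {ξ η : ℝ → EuclideanSpace ℝ (Fin n)}
    (hξ : IsTrajectory f t T x u v ξ) (hη : IsTrajectory f t T x u v η) :
    EqOn ξ η (Icc t T) := by
  intro τ hτ
  have := hξ.norm_sub_le hf hu hv hη hτ
  rw [sub_self, norm_zero, mul_zero] at this
  exact sub_eq_zero.1 (norm_le_zero_iff.1 this)

/-- Existence of Carathéodory solutions: the substitution `ξ s = exp ((2 * K + 1) s) • η s` turns
the integral operator into a contraction of the space of continuous functions. -/
lemma RegularDynamics.exists_isTrajectory (hf : RegularDynamics f U V C K) (htT : t ≤ T)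
    (hu : u ∈ Inputs U t T) (hv : v ∈ Inputs V t T) (x : EuclideanSpace ℝ (Fin n)) :
    ∃ ξ, IsTrajectory f t T x u v ξ := by
  have ht : t ∈ Icc t T := ⟨le_rfl, htT⟩
  let lift : C(Icc t T, EuclideanSpace ℝ (Fin n)) → ℝ → EuclideanSpace ℝ (Fin n) :=
    fun η s => Real.exp ((2 * K + 1) * s) • η (projIcc t T htT s)
  have hlift : ∀ η, Continuous (lift η) := fun η => by
    have := continuous_projIcc (h := htT)
    fun_prop
  have hcont : ∀ η, ContinuousOn (fun τ => ∫ s in t..τ, f (lift η s) (u s) (v s)) (Icc t T) := by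
    intro η
    have := intervalIntegral.continuousOn_primitive_interval'
      (hf.intervalIntegrable hu hv (hlift η).continuousOn ht ⟨htT, le_rfl⟩) left_mem_uIcc
    rwa [uIcc_of_le htT] at this
  let Ψ : C(Icc t T, EuclideanSpace ℝ (Fin n)) → C(Icc t T, EuclideanSpace ℝ (Fin n)) :=
    fun η => ⟨fun τ => Real.exp (-((2 * K + 1) * τ)) •
      (x + ∫ s in t..τ, f (lift η s) (u s) (v s)), by
        have := (hcont η).domRestrict
        have h : Continuous fun τ : Icc t T => Real.exp (-((2 * K + 1) * (τ : ℝ))) := by fun_prop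
        exact h.smul (continuous_const.add this)⟩
  have hΨ : ContractingWith (1 / 2 : NNReal) Ψ := by
    refine ⟨by norm_num, LipschitzWith.of_dist_le_mul fun η η' => ?_⟩
    rw [ContinuousMap.dist_le (by positivity)]
    rintro ⟨τ, hτ⟩
    have h1 := hf.norm_integral_sub_le hu hv (hlift η).continuousOn (hlift η').continuousOn
      (dist_nonneg (x := η) (y := η')) (fun s hs => ?_) hτ
    · calc dist (Ψ η ⟨τ, hτ⟩) (Ψ η' ⟨τ, hτ⟩)
          = Real.exp (-((2 * K + 1) * τ)) * ‖(∫ s in t..τ, f (lift η s) (u s) (v s)) -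
              ∫ s in t..τ, f (lift η' s) (u s) (v s)‖ := by
            simp only [Ψ, ContinuousMap.coe_mk]
            rw [dist_eq_norm, ← smul_sub, add_sub_add_left_eq_sub, norm_smul, Real.norm_eq_abs,
              Real.abs_exp]
        _ ≤ Real.exp (-((2 * K + 1) * τ)) *
              (dist η η' / 2 * Real.exp ((2 * K + 1) * τ)) := by gcongr
        _ = dist η η' / 2 * (Real.exp (-((2 * K + 1) * τ)) * Real.exp ((2 * K + 1) * τ)) := by
            ring
        _ = _ := by rw [← Real.exp_add]; simp; ring
    · rw [← smul_sub, norm_smul, Real.norm_eq_abs, Real.abs_exp, mul_comm, ← dist_eq_norm]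
      gcongr
      exact ContinuousMap.dist_apply_le_dist _
  set η := hΨ.fixedPoint Ψ with hη
  have hfix : Ψ η = η := hΨ.fixedPoint_isFixedPt
  refine ⟨lift η, (hlift η).continuousOn,
    hf.intervalIntegrable hu hv (hlift η).continuousOn ht ⟨htT, le_rfl⟩, fun τ hτ => ?_⟩
  have h1 : η ⟨τ, hτ⟩ = Real.exp (-((2 * K + 1) * τ)) •
      (x + ∫ s in t..τ, f (lift η s) (u s) (v s)) := by
    conv_lhs => rw [← hfix]
    rfl
  have h2 : lift η τ = Real.exp ((2 * K + 1) * τ) • η ⟨τ, hτ⟩ := by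
    simp only [lift, projIcc_of_mem htT hτ]
  rw [h2, h1, smul_smul, ← Real.exp_add, add_neg_cancel, Real.exp_zero, one_smul]

lemma RegularDynamics.isTrajectory (hf : RegularDynamics f U V C K) (htT : t ≤ T)
    (hu : u ∈ Inputs U t T) (hv : v ∈ Inputs V t T) (x : EuclideanSpace ℝ (Fin n)) :
    IsTrajectory f t T x u v (trajectory f t T x u v) := by
  have H := hf.exists_isTrajectory htT hu hv x
  rw [trajectory, dif_pos H]
  exact H.choose_spec







lemma IsTrajectory.norm_sub_le_mul (hf : RegularDynamics f U V C K)
    (hu : u ∈ Inputs U t T) (hv : v ∈ Inputs V t T)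
    {x : EuclideanSpace ℝ (Fin n)} {ξ : ℝ → EuclideanSpace ℝ (Fin n)}
    (hξ : IsTrajectory f t T x u v ξ) {τ : ℝ} (hτ : τ ∈ Icc t T) :
    ‖ξ τ - x‖ ≤ C * (τ - t) := by
  have h := hξ.sub_eq ⟨le_rfl, hτ.1.trans hτ.2⟩ hτ
  rw [hξ.apply_left (hτ.1.trans hτ.2)] at h
  rw [h, ← abs_of_nonneg (sub_nonneg.2 hτ.1)]
  refine intervalIntegral.norm_integral_le_of_norm_le_const fun s hs => ?_
  rw [uIoc_of_le hτ.1] at hs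
  have hs' : s ∈ Icc t T := ⟨hs.1.le, hs.2.trans hτ.2⟩
  exact hf.bound _ _ (hu.2 s hs') _ (hv.2 s hs')

end Regular

/-! ### Inputs, payoffs and values -/

/-- The input that follows `u₁` before time `t'` and `u₂` from `t'` on. -/
noncomputable def concat {A : Type*} (t' : ℝ) (u₁ u₂ : ℝ → A) : ℝ → A :=
  fun τ => if τ < t' then u₁ τ else u₂ τ

/-- A cost function bounded by `D` and `L`-Lipschitz. -/
structure RegularCost {n : ℕ} (g : EuclideanSpace ℝ (Fin n) → ℝ) (D L : ℝ) : Prop where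
  lip_nonneg : 0 ≤ L
  bound : ∀ x, |g x| ≤ D
  lip : ∀ x y, |g x - g y| ≤ L * ‖x - y‖

section Inputs

variable {A : Type*} [MeasurableSpace A] {U : Set A} {t t' T : ℝ} {u u₁ u₂ : ℝ → A}

lemma const_mem_inputs {a : A} (ha : a ∈ U) : (fun _ : ℝ => a) ∈ Inputs U t T :=
  ⟨aemeasurable_const, fun _ _ => ha⟩

lemma inputs_mono {t₁ T₁ : ℝ} (hu : u ∈ Inputs U t T) (ht : t ≤ t₁) (hT : T₁ ≤ T) :
    u ∈ Inputs U t₁ T₁ :=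
  ⟨hu.1.mono_measure (Measure.restrict_mono (Icc_subset_Icc ht hT) le_rfl),
    fun τ hτ => hu.2 τ (Icc_subset_Icc ht hT hτ)⟩

lemma concat_ae_left :
    ∀ᵐ τ ∂(volume.restrict (Icc t t')), concat t' u₁ u₂ τ = u₁ τ := by
  filter_upwards [ae_restrict_mem measurableSet_Icc,
    ae_restrict_of_ae (Measure.ae_ne volume t')] with τ hτ hne
  exact if_pos (lt_of_le_of_ne hτ.2 hne)

lemma concat_ae_right :
    ∀ᵐ τ ∂(volume.restrict (Icc t' T)), concat t' u₁ u₂ τ = u₂ τ := by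
  filter_upwards [ae_restrict_mem measurableSet_Icc] with τ hτ
  exact if_neg hτ.1.not_gt

lemma concat_mem_inputs (ht' : t' ∈ Icc t T) (h₁ : u₁ ∈ Inputs U t T) (h₂ : u₂ ∈ Inputs U t' T) :
    concat t' u₁ u₂ ∈ Inputs U t T := by
  refine ⟨?_, fun τ hτ => ?_⟩
  · rw [← Icc_union_Icc_eq_Icc ht'.1 ht'.2, aemeasurable_union_iff]
    refine ⟨(inputs_mono h₁ le_rfl ht'.2).1.congr ?_, h₂.1.congr ?_⟩
    · filter_upwards [concat_ae_left (t := t) (t' := t') (u₁ := u₁) (u₂ := u₂)] with τ hτ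
      exact hτ.symm
    · filter_upwards [concat_ae_right (t' := t') (T := T) (u₁ := u₁) (u₂ := u₂)] with τ hτ
      exact hτ.symm
  · unfold concat
    split_ifs with hlt
    · exact h₁.2 τ hτ
    · exact h₂.2 τ ⟨not_lt.1 hlt, hτ.2⟩

lemma NonAnticipative.const {B : Type*} [MeasurableSpace B] {V : Set B} {a : A} (ha : a ∈ U) :
    NonAnticipative (fun _ : Inputs V t T => (⟨fun _ => a, const_mem_inputs ha⟩ : Inputs U t T)) :=
  fun _ _ _ _ _ => Filter.Eventually.of_forall fun _ => rfl

end Inputs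

section Payoff

variable {n : ℕ} {l h : EuclideanSpace ℝ (Fin n) → ℝ} {D L t T c : ℝ}
  {ξ : ℝ → EuclideanSpace ℝ (Fin n)}

lemma RegularCost.bddAbove {ι : Sort*} (hh : RegularCost h D L)
    (ξ : ι → EuclideanSpace ℝ (Fin n)) : BddAbove (range fun τ => h (ξ τ)) :=
  ⟨D, by rintro _ ⟨τ, rfl⟩; exact (abs_le.1 (hh.bound _)).2⟩

lemma payoff_le_iff (hh : RegularCost h D L) (htT : t ≤ T) :
    payoff l h t T ξ ≤ c ↔ l (ξ T) ≤ c ∧ ∀ τ ∈ Icc t T, h (ξ τ) ≤ c := by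
  have : Nonempty (Icc t T) := ⟨⟨t, le_rfl, htT⟩⟩
  rw [payoff, max_le_iff, ciSup_le_iff (hh.bddAbove _)]
  simp

lemma payoff_le (hl : RegularCost l D L) (hh : RegularCost h D L) (htT : t ≤ T) :
    payoff l h t T ξ ≤ D :=
  (payoff_le_iff hh htT).2 ⟨(abs_le.1 (hl.bound _)).2, fun _ _ => (abs_le.1 (hh.bound _)).2⟩

lemma neg_le_payoff (hl : RegularCost l D L) : -D ≤ payoff l h t T ξ :=
  (abs_le.1 (hl.bound _)).1.trans (le_max_left _ _)

lemma le_payoff (hh : RegularCost h D L) {τ : ℝ} (hτ : τ ∈ Icc t T) :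
    h (ξ τ) ≤ payoff l h t T ξ :=
  ((payoff_le_iff hh (hτ.1.trans hτ.2)).1 le_rfl).2 τ hτ

variable {A B : Type*} [MeasurableSpace A] [MeasurableSpace B]
  {f : EuclideanSpace ℝ (Fin n) → A → B → EuclideanSpace ℝ (Fin n)}
  {U : Set A} {V : Set B} {x : EuclideanSpace ℝ (Fin n)}

lemma value_le (hV : V.Nonempty) (hl : RegularCost l D L) (hh : RegularCost h D L)
    (htT : t ≤ T) {γ : Inputs V t T → Inputs U t T} (hγ : NonAnticipative γ)
    (hc : ∀ v, payoff l h t T (trajectory f t T x (γ v).1 v.1) ≤ c) :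
    value f U V l h T (x, t) ≤ c := by
  obtain ⟨b, hb⟩ := hV
  have hne : Nonempty (Inputs V t T) := ⟨⟨fun _ => b, const_mem_inputs hb⟩⟩
  refine (ciInf_le ⟨-D, ?_⟩ (⟨γ, hγ⟩ : Strategies U V t T)).trans (ciSup_le hc)
  rintro _ ⟨γ', rfl⟩
  refine (neg_le_payoff hl).trans (le_ciSup (f := fun v : Inputs V t T =>
    payoff l h t T (trajectory f t T x (γ'.1 v).1 v.1)) ⟨D, ?_⟩ hne.some)
  rintro _ ⟨v, rfl⟩
  exact payoff_le hl hh htT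

lemma exists_strategy_of_value_lt (hU : U.Nonempty) (hl : RegularCost l D L)
    (hh : RegularCost h D L) (htT : t ≤ T) (hc : value f U V l h T (x, t) < c) :
    ∃ γ : Inputs V t T → Inputs U t T, NonAnticipative γ ∧
      ∀ v, payoff l h t T (trajectory f t T x (γ v).1 v.1) < c := by
  obtain ⟨a, ha⟩ := hU
  have hne : Nonempty (Strategies U V t T) := ⟨⟨_, NonAnticipative.const ha⟩⟩
  obtain ⟨γ, hγ⟩ := exists_lt_of_ciInf_lt hc
  refine ⟨γ.1, γ.2, fun v => lt_of_le_of_lt (le_ciSup (f := fun v : Inputs V t T =>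
    payoff l h t T (trajectory f t T x (γ.1 v).1 v.1)) ⟨D, ?_⟩ v) hγ⟩
  rintro _ ⟨v, rfl⟩
  exact payoff_le hl hh htT

lemma le_value (hU : U.Nonempty) (hl : RegularCost l D L)
    (hh : RegularCost h D L) (htT : t ≤ T)
    (hc : ∀ γ : Inputs V t T → Inputs U t T, NonAnticipative γ →
      ∃ v, c ≤ payoff l h t T (trajectory f t T x (γ v).1 v.1)) :
    c ≤ value f U V l h T (x, t) := by
  by_contra! hlt
  obtain ⟨γ, hγ, H⟩ := exists_strategy_of_value_lt hU hl hh htT hlt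
  obtain ⟨v, hv⟩ := hc γ hγ
  exact (H v).not_ge hv

end Payoff

section DynamicProgramming

variable {n : ℕ} {A B : Type*}
  [TopologicalSpace A] [SecondCountableTopology A] [T2Space A] [MeasurableSpace A] [BorelSpace A]
  [TopologicalSpace B] [SecondCountableTopology B] [T2Space B] [MeasurableSpace B] [BorelSpace B]
  {f : EuclideanSpace ℝ (Fin n) → A → B → EuclideanSpace ℝ (Fin n)}
  {U : Set A} {V : Set B} {C K D L t t' T c : ℝ} {l h : EuclideanSpace ℝ (Fin n) → ℝ}
  {x : EuclideanSpace ℝ (Fin n)}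

/-! ### The dynamic programming principle -/

lemma RegularDynamics.trajectory_eqOn_left (hf : RegularDynamics f U V C K) (ht' : t' ∈ Icc t T)
    {u u' : ℝ → A} {v v' : ℝ → B} (hu : u ∈ Inputs U t T) (hu' : u' ∈ Inputs U t T)
    (hv : v ∈ Inputs V t T) (hv' : v' ∈ Inputs V t T)
    (huu : ∀ᵐ τ ∂(volume.restrict (Icc t t')), u τ = u' τ)
    (hvv : ∀ᵐ τ ∂(volume.restrict (Icc t t')), v τ = v' τ) :
    EqOn (trajectory f t T x u v) (trajectory f t T x u' v') (Icc t t') := by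
  have htT := ht'.1.trans ht'.2
  exact (((hf.isTrajectory htT hu hv x).mono ht').congr ht'.1 huu hvv).eqOn hf
    (inputs_mono hu' le_rfl ht'.2) (inputs_mono hv' le_rfl ht'.2)
    ((hf.isTrajectory htT hu' hv' x).mono ht')

lemma RegularDynamics.trajectory_eqOn_right (hf : RegularDynamics f U V C K) (ht' : t' ∈ Icc t T)
    {u u' : ℝ → A} {v v' : ℝ → B} (hu : u ∈ Inputs U t T) (hu' : u' ∈ Inputs U t' T)
    (hv : v ∈ Inputs V t T) (hv' : v' ∈ Inputs V t' T)
    (huu : ∀ᵐ τ ∂(volume.restrict (Icc t' T)), u τ = u' τ)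
    (hvv : ∀ᵐ τ ∂(volume.restrict (Icc t' T)), v τ = v' τ) :
    EqOn (trajectory f t T x u v) (trajectory f t' T (trajectory f t T x u v t') u' v')
      (Icc t' T) := by
  have htT := ht'.1.trans ht'.2
  exact (((hf.isTrajectory htT hu hv x).tail ht').congr ht'.2 huu hvv).eqOn hf hu' hv'
    (hf.isTrajectory ht'.2 hu' hv' _)

/-- One half of the dynamic programming principle: a strategy that keeps the running cost up to
time `t'` and the value at time `t'` below `c` bounds the value at time `t`. It is followed up to
`t'` and continued by a strategy that is nearly optimal from the state reached then. -/
lemma value_le_of_strategy (hf : RegularDynamics f U V C K) (hl : RegularCost l D L)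
    (hh : RegularCost h D L) (ht' : t' ∈ Icc t T)
    {γ : Inputs V t T → Inputs U t T} (hγ : NonAnticipative γ)
    (hc : ∀ v, (∀ τ ∈ Icc t t', h (trajectory f t T x (γ v).1 v.1 τ) ≤ c) ∧
      value f U V l h T (trajectory f t T x (γ v).1 v.1 t', t') ≤ c) :
    value f U V l h T (x, t) ≤ c := by
  have htT := ht'.1.trans ht'.2
  refine le_of_forall_pos_le_add fun ε hε => ?_
  have hex : ∀ y, ∃ γ₂ : Inputs V t' T → Inputs U t' T, NonAnticipative γ₂ ∧
      (value f U V l h T (y, t') < c + ε →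
        ∀ v, payoff l h t' T (trajectory f t' T y (γ₂ v).1 v.1) < c + ε) := by
    intro y
    by_cases hy : value f U V l h T (y, t') < c + ε
    · obtain ⟨γ₂, h1, h2⟩ := exists_strategy_of_value_lt hf.nonempty_left hl hh ht'.2 hy
      exact ⟨γ₂, h1, fun _ => h2⟩
    · obtain ⟨a, ha⟩ := hf.nonempty_left
      exact ⟨_, NonAnticipative.const ha, fun h => absurd h hy⟩
  choose γ₂ hγ₂ hγ₂c using hex
  set ξ : Inputs V t T → ℝ → EuclideanSpace ℝ (Fin n) :=
    fun v => trajectory f t T x (γ v).1 v.1 with hξ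
  let r : Inputs V t T → Inputs V t' T := fun v => ⟨v.1, inputs_mono v.2 ht'.1 le_rfl⟩
  let Γ : Inputs V t T → Inputs U t T := fun v =>
    ⟨concat t' (γ v).1 (γ₂ (ξ v t') (r v)).1, concat_mem_inputs ht' (γ v).2 (γ₂ (ξ v t') (r v)).2⟩
  have hΓ : NonAnticipative Γ := by
    intro s hs v v' hvv
    rcases lt_or_ge s t' with hst | hst
    · filter_upwards [hγ s hs v v' hvv, ae_restrict_mem measurableSet_Icc] with τ h1 h2
      simp only [Γ, concat, if_pos (h2.2.trans_lt hst), h1]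
    · have hvv₁ := ae_restrict_of_ae_restrict_of_subset (Icc_subset_Icc_right hst) hvv
      have hvv₂ := ae_restrict_of_ae_restrict_of_subset (Icc_subset_Icc_left ht'.1) hvv
      have h1 := hγ t' ht' v v' hvv₁
      have h2 : ξ v t' = ξ v' t' :=
        hf.trajectory_eqOn_left ht' (γ v).2 (γ v').2 v.2 v'.2 h1 hvv₁ ⟨ht'.1, le_rfl⟩
      have h3 := hγ₂ (ξ v t') s ⟨hst, hs.2⟩ (r v) (r v') hvv₂
      rw [← Icc_union_Icc_eq_Icc ht'.1 hst, ae_restrict_union_iff]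
      refine ⟨?_, ?_⟩
      · filter_upwards [h1, concat_ae_left (t := t) (t' := t') (u₁ := (γ v).1)
          (u₂ := (γ₂ (ξ v t') (r v)).1), concat_ae_left (t := t) (t' := t') (u₁ := (γ v').1)
          (u₂ := (γ₂ (ξ v' t') (r v')).1)] with τ g1 g2 g3
        exact g2.trans (g1.trans g3.symm)
      · filter_upwards [h3, ae_restrict_mem measurableSet_Icc] with τ g1 g2
        simp only [Γ, concat, if_neg g2.1.not_gt, ← h2, g1]
  refine value_le hf.nonempty_right hl hh htT hΓ fun v => ?_
  have e1 : EqOn (trajectory f t T x (Γ v).1 v.1) (ξ v) (Icc t t') :=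
    hf.trajectory_eqOn_left ht' (Γ v).2 (γ v).2 v.2 v.2 concat_ae_left (by simp)
  have e2 := hf.trajectory_eqOn_right (x := x) ht' (Γ v).2 (γ₂ (ξ v t') (r v)).2 v.2 (r v).2
    concat_ae_right (by simp [r])
  rw [e1 ⟨ht'.1, le_rfl⟩] at e2
  have hp := (payoff_le_iff hh ht'.2).1
    (hγ₂c (ξ v t') ((hc v).2.trans_lt (lt_add_of_pos_right c hε)) (r v)).le
  refine (payoff_le_iff hh htT).2 ⟨?_, fun τ hτ => ?_⟩
  · rw [e2 ⟨ht'.2, le_rfl⟩]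
    exact hp.1
  · rcases le_total τ t' with hle | hle
    · rw [e1 ⟨hτ.1, hle⟩]
      exact ((hc v).1 τ ⟨hτ.1, hle⟩).trans (by linarith)
    · rw [e2 ⟨hle, hτ.2⟩]
      exact hp.2 τ ⟨hle, hτ.2⟩

/-- The other half of the dynamic programming principle. After any input of the second player on
`[t, t']`, the rest of a strategy on `[t, T]` is a strategy on `[t', T]`. -/
lemma exists_strategy_forall_value_le (hf : RegularDynamics f U V C K) (hl : RegularCost l D L)
    (hh : RegularCost h D L) (ht' : t' ∈ Icc t T) (hc : value f U V l h T (x, t) < c) :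
    ∃ γ : Inputs V t T → Inputs U t T, NonAnticipative γ ∧
      ∀ v, (∀ τ ∈ Icc t t', h (trajectory f t T x (γ v).1 v.1 τ) ≤ c) ∧
        value f U V l h T (trajectory f t T x (γ v).1 v.1 t', t') ≤ c := by
  have htT := ht'.1.trans ht'.2
  obtain ⟨γ, hγ, H⟩ := exists_strategy_of_value_lt hf.nonempty_left hl hh htT hc
  refine ⟨γ, hγ, fun v => ⟨fun τ hτ => (le_payoff hh ⟨hτ.1, hτ.2.trans ht'.2⟩).trans (H v).le,
    ?_⟩⟩
  let j : Inputs V t' T → Inputs V t T := fun w =>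
    ⟨concat t' v.1 w.1, concat_mem_inputs ht' v.2 w.2⟩
  let Γ : Inputs V t' T → Inputs U t' T := fun w =>
    ⟨(γ (j w)).1, inputs_mono (γ (j w)).2 ht'.1 le_rfl⟩
  have hΓ : NonAnticipative Γ := by
    intro s hs w w' hww
    have h1 : ∀ᵐ τ ∂(volume.restrict (Icc t s)), (j w).1 τ = (j w').1 τ := by
      rw [← Icc_union_Icc_eq_Icc ht'.1 hs.1, ae_restrict_union_iff]
      refine ⟨?_, ?_⟩
      · filter_upwards [concat_ae_left (t := t) (t' := t') (u₁ := v.1) (u₂ := w.1),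
          concat_ae_left (t := t) (t' := t') (u₁ := v.1) (u₂ := w'.1)] with τ g1 g2
        exact g1.trans g2.symm
      · filter_upwards [hww, ae_restrict_mem measurableSet_Icc] with τ g1 g2
        simp only [j, concat, if_neg g2.1.not_gt, g1]
    exact ae_restrict_of_ae_restrict_of_subset (Icc_subset_Icc_left ht'.1)
      (hγ s ⟨ht'.1.trans hs.1, hs.2⟩ _ _ h1)
  refine value_le hf.nonempty_right hl hh ht'.2 hΓ fun w => ?_
  have hvj : ∀ᵐ τ ∂(volume.restrict (Icc t t')), v.1 τ = (j w).1 τ := by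
    filter_upwards [concat_ae_left (t := t) (t' := t') (u₁ := v.1) (u₂ := w.1)] with τ g
    exact g.symm
  have e1 := hf.trajectory_eqOn_left (x := x) ht' (γ v).2 (γ (j w)).2 v.2 (j w).2
    (hγ t' ht' v (j w) hvj) hvj ⟨ht'.1, le_rfl⟩
  have e2 := hf.trajectory_eqOn_right (x := x) ht' (γ (j w)).2 (Γ w).2 (j w).2 w.2
    (by simp [Γ]) concat_ae_right
  rw [← e1] at e2
  have hp := (payoff_le_iff hh htT).1 (H (j w)).le
  refine (payoff_le_iff hh ht'.2).2 ⟨?_, fun τ hτ => ?_⟩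
  · rw [← e2 ⟨ht'.2, le_rfl⟩]
    exact hp.1
  · rw [← e2 hτ]
    exact hp.2 τ ⟨ht'.1.trans hτ.1, hτ.2⟩

/-! ### Regularity of the value function -/

lemma le_value_obstacle (hf : RegularDynamics f U V C K) (hl : RegularCost l D L)
    (hh : RegularCost h D L) (htT : t ≤ T) : h x ≤ value f U V l h T (x, t) := by
  obtain ⟨b, hb⟩ := hf.nonempty_right
  refine le_value hf.nonempty_left hl hh htT fun γ _ => ⟨⟨fun _ => b, const_mem_inputs hb⟩, ?_⟩
  have := le_payoff (l := l) (ξ := trajectory f t T x (γ ⟨fun _ => b, const_mem_inputs hb⟩).1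
    (fun _ => b)) hh (left_mem_Icc.2 htT)
  rwa [(hf.isTrajectory htT (γ _).2 (const_mem_inputs hb) x).apply_left htT] at this

lemma value_terminal (hf : RegularDynamics f U V C K) (hl : RegularCost l D L)
    (hh : RegularCost h D L) : value f U V l h T (x, T) = max (l x) (h x) := by
  have key : ∀ (γ : Inputs V T T → Inputs U T T) (v : Inputs V T T),
      trajectory f T T x (γ v).1 v.1 T = x := fun γ v =>
    (hf.isTrajectory le_rfl (γ v).2 v.2 x).apply_left le_rfl
  have hp : ∀ (γ : Inputs V T T → Inputs U T T) (v : Inputs V T T) (c : ℝ),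
      payoff l h T T (trajectory f T T x (γ v).1 v.1) ≤ c ↔ max (l x) (h x) ≤ c := by
    intro γ v c
    rw [payoff_le_iff hh le_rfl, max_le_iff]
    simp [key]
  obtain ⟨a, ha⟩ := hf.nonempty_left
  obtain ⟨b, hb⟩ := hf.nonempty_right
  refine le_antisymm ?_ ?_
  · exact value_le hf.nonempty_right hl hh le_rfl (NonAnticipative.const ha)
      fun v => (hp (fun _ => ⟨fun _ => a, const_mem_inputs ha⟩) v _).2 le_rfl
  · exact le_value hf.nonempty_left hl hh le_rfl fun γ _ =>
      ⟨⟨fun _ => b, const_mem_inputs hb⟩, (hp _ _ _).1 le_rfl⟩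

/-- The Lipschitz constant in the state of the value function on a horizon of length `T`. -/
noncomputable def valueLip (K L T : ℝ) : ℝ := L * (2 * Real.exp ((2 * K + 1) * T))

lemma value_le_add_space (hf : RegularDynamics f U V C K) (hl : RegularCost l D L)
    (hh : RegularCost h D L) (ht : t ∈ Icc 0 T) (x y : EuclideanSpace ℝ (Fin n)) :
    value f U V l h T (x, t) ≤ value f U V l h T (y, t) + valueLip K L T * ‖x - y‖ := by
  have hK := hf.lip_nonneg
  have hL := hl.lip_nonneg
  refine le_of_forall_pos_le_add fun ε hε => ?_
  obtain ⟨γ, hγ, H⟩ := exists_strategy_of_value_lt hf.nonempty_left hl hh ht.2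
    (lt_add_of_pos_right (value f U V l h T (y, t)) hε)
  refine value_le hf.nonempty_right hl hh ht.2 hγ fun v => ?_
  have hd : ∀ τ ∈ Icc t T, ∀ g, RegularCost g D L →
      g (trajectory f t T x (γ v).1 v.1 τ) ≤
        g (trajectory f t T y (γ v).1 v.1 τ) + valueLip K L T * ‖x - y‖ := by
    intro τ hτ g hg
    have h1 := (hf.isTrajectory ht.2 (γ v).2 v.2 x).norm_sub_le hf (γ v).2 v.2
      (hf.isTrajectory ht.2 (γ v).2 v.2 y) hτ
    have h2 : Real.exp ((2 * K + 1) * (τ - t)) ≤ Real.exp ((2 * K + 1) * T) := by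
      have h1 := hτ.2
      have h2 := ht.1
      gcongr
      linarith
    have h3 := (abs_le.1 (hg.lip (trajectory f t T x (γ v).1 v.1 τ)
      (trajectory f t T y (γ v).1 v.1 τ))).2
    have h4 : L * ‖trajectory f t T x (γ v).1 v.1 τ - trajectory f t T y (γ v).1 v.1 τ‖ ≤
        valueLip K L T * ‖x - y‖ := by
      rw [valueLip, mul_assoc L]
      refine mul_le_mul_of_nonneg_left (h1.trans ?_) hL
      gcongr
    linarith
  have hp := (payoff_le_iff hh ht.2).1 (H v).le
  refine (payoff_le_iff hh ht.2).2 ⟨?_, fun τ hτ => ?_⟩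
  · linarith [hd T ⟨ht.2, le_rfl⟩ l hl, hp.1]
  · linarith [hd τ hτ h hh, hp.2 τ hτ]

lemma valueLip_nonneg (hL : 0 ≤ L) : 0 ≤ valueLip K L T := by
  unfold valueLip; positivity

lemma le_valueLip (hK : 0 ≤ K) (hL : 0 ≤ L) (hT : 0 ≤ T) : L ≤ valueLip K L T := by
  have : 1 ≤ Real.exp ((2 * K + 1) * T) := Real.one_le_exp (by positivity)
  unfold valueLip
  nlinarith

lemma abs_value_sub_le_time (hf : RegularDynamics f U V C K) (hl : RegularCost l D L)
    (hh : RegularCost h D L) (ht : 0 ≤ t) (ht' : t' ∈ Icc t T) :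
    |value f U V l h T (x, t) - value f U V l h T (x, t')| ≤
      valueLip K L T * (C * (t' - t)) := by
  have hK := hf.lip_nonneg
  have hL := hl.lip_nonneg
  have htT := ht'.1.trans ht'.2
  have hvL := valueLip_nonneg (K := K) (T := T) hL
  have hLL := le_valueLip hK hL (ht.trans htT)
  have hC := hf.bound_nonneg
  have hnear : ∀ (γ : Inputs V t T → Inputs U t T) (v : Inputs V t T), ∀ τ ∈ Icc t t',
      ‖trajectory f t T x (γ v).1 v.1 τ - x‖ ≤ C * (t' - t) := by
    intro γ v τ hτ
    refine ((hf.isTrajectory htT (γ v).2 v.2 x).norm_sub_le_mul hf (γ v).2 v.2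
      ⟨hτ.1, hτ.2.trans ht'.2⟩).trans ?_
    gcongr
    exact hτ.2
  obtain ⟨a, ha⟩ := hf.nonempty_left
  obtain ⟨b, hb⟩ := hf.nonempty_right
  rw [abs_le]
  constructor
  · rw [neg_le_sub_iff_le_add]
    refine le_of_forall_pos_le_add fun ε hε => ?_
    obtain ⟨γ, hγ, H⟩ := exists_strategy_forall_value_le hf hl hh ht'
      (lt_add_of_pos_right (value f U V l h T (x, t)) hε)
    have h1 := (H ⟨fun _ => b, const_mem_inputs hb⟩).2
    set y := trajectory f t T x (γ ⟨fun _ => b, const_mem_inputs hb⟩).1 (fun _ => b) t' with hy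
    have h2 := hnear γ ⟨fun _ => b, const_mem_inputs hb⟩ t' ⟨ht'.1, le_rfl⟩
    have h3 := value_le_add_space hf hl hh ⟨ht.trans ht'.1, ht'.2⟩ x y
    rw [norm_sub_rev] at h3
    have := mul_le_mul_of_nonneg_left h2 hvL
    linarith
  · rw [sub_le_iff_le_add']
    refine value_le_of_strategy hf hl hh ht' (NonAnticipative.const ha) fun v => ⟨?_, ?_⟩
    · intro τ hτ
      have h1 := le_value_obstacle (x := x) hf hl hh ht'.2
      have h2 := (abs_le.1 (hh.lip (trajectory f t T x (fun _ => a) v.1 τ) x)).2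
      have h3 := hnear (fun _ => ⟨fun _ => a, const_mem_inputs ha⟩) v τ hτ
      have := mul_le_mul hLL h3 (norm_nonneg _) hvL
      linarith
    · have h3 := hnear (fun _ => ⟨fun _ => a, const_mem_inputs ha⟩) v t' ⟨ht'.1, le_rfl⟩
      refine (value_le_add_space hf hl hh ⟨ht.trans ht'.1, ht'.2⟩ _ x).trans ?_
      gcongr

lemma continuousOn_value (hf : RegularDynamics f U V C K) (hl : RegularCost l D L)
    (hh : RegularCost h D L) :
    ContinuousOn (value f U V l h T) (univ ×ˢ Icc 0 T) := by
  have hvL := valueLip_nonneg (K := K) (T := T) hl.lip_nonneg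
  have hC := hf.bound_nonneg
  refine continuousOn_prod_of_continuousOn_lipschitzOnWith _ (Real.toNNReal (valueLip K L T))
    (fun x _ => ?_) (fun t ht => LipschitzOnWith.of_dist_le_mul fun x _ y _ => ?_)
  · refine LipschitzOnWith.continuousOn (K := Real.toNNReal (valueLip K L T * C))
      (LipschitzOnWith.of_dist_le_mul fun t ht s hs => ?_)
    rw [Real.coe_toNNReal _ (by positivity), Real.dist_eq, Real.dist_eq]
    rcases le_total t s with hts | hst
    · rw [abs_sub_comm t s, abs_of_nonneg (sub_nonneg.2 hts), mul_assoc]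
      exact abs_value_sub_le_time hf hl hh ht.1 ⟨hts, hs.2⟩
    · rw [abs_sub_comm, abs_of_nonneg (sub_nonneg.2 hst), mul_assoc]
      exact abs_value_sub_le_time hf hl hh hs.1 ⟨hst, ht.2⟩
  · rw [Real.coe_toNNReal _ hvL, Real.dist_eq, dist_eq_norm, abs_sub_le_iff]
    have h1 := value_le_add_space hf hl hh ht x y
    have h2 := value_le_add_space hf hl hh ht y x
    rw [norm_sub_rev] at h2
    constructor <;> linarith

end DynamicProgramming

section Hamiltonian

variable {n : ℕ} {A B : Type*} [TopologicalSpace A] [TopologicalSpace B]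
  {f : EuclideanSpace ℝ (Fin n) → A → B → EuclideanSpace ℝ (Fin n)}
  {U : Set A} {V : Set B} {C K c : ℝ} {x y p q : EuclideanSpace ℝ (Fin n)}

/-! ### The Hamiltonian -/

lemma RegularDynamics.abs_inner_le (hf : RegularDynamics f U V C K) {a : A} {b : B}
    (ha : a ∈ U) (hb : b ∈ V) : |inner ℝ p (f x a b)| ≤ ‖p‖ * C :=
  (abs_real_inner_le_norm _ _).trans
    (mul_le_mul_of_nonneg_left (hf.bound x a ha b hb) (norm_nonneg p))

lemma RegularDynamics.bddBelow_inner (hf : RegularDynamics f U V C K) {b : B} (hb : b ∈ V) :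
    BddBelow (range fun a : U => inner ℝ p (f x a b)) :=
  ⟨-(‖p‖ * C), by rintro _ ⟨a, rfl⟩; exact (abs_le.1 (hf.abs_inner_le a.2 hb)).1⟩

lemma RegularDynamics.bddAbove_iInf_inner (hf : RegularDynamics f U V C K) :
    BddAbove (range fun b : V => ⨅ a : U, inner ℝ p (f x a b)) := by
  obtain ⟨a, ha⟩ := hf.nonempty_left
  refine ⟨‖p‖ * C, ?_⟩
  rintro _ ⟨b, rfl⟩
  exact (ciInf_le (hf.bddBelow_inner b.2) ⟨a, ha⟩).trans (abs_le.1 (hf.abs_inner_le ha b.2)).2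

lemma RegularDynamics.exists_lt_of_hamiltonian_lt (hf : RegularDynamics f U V C K)
    (h : hamiltonian f U V x p < c) {b : B} (hb : b ∈ V) : ∃ a ∈ U, inner ℝ p (f x a b) < c := by
  have : Nonempty U := hf.nonempty_left.to_subtype
  obtain ⟨a, ha⟩ := exists_lt_of_ciInf_lt
    ((le_ciSup hf.bddAbove_iInf_inner (⟨b, hb⟩ : V)).trans_lt h)
  exact ⟨a, a.2, ha⟩

lemma RegularDynamics.exists_lt_of_lt_hamiltonian (hf : RegularDynamics f U V C K)
    (h : c < hamiltonian f U V x p) : ∃ b ∈ V, ∀ a ∈ U, c < inner ℝ p (f x a b) := by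
  have : Nonempty V := hf.nonempty_right.to_subtype
  obtain ⟨b, hb⟩ := exists_lt_of_lt_ciSup h
  exact ⟨b, b.2, fun a ha => hb.trans_le (ciInf_le (hf.bddBelow_inner b.2) (⟨a, ha⟩ : U))⟩

lemma RegularDynamics.hamiltonian_le_add (hf : RegularDynamics f U V C K)
    (h : ∀ a ∈ U, ∀ b ∈ V, inner ℝ p (f x a b) ≤ inner ℝ q (f y a b) + c) :
    hamiltonian f U V x p ≤ hamiltonian f U V y q + c := by
  by_contra! hlt
  have : Nonempty U := hf.nonempty_left.to_subtype
  have h1 : hamiltonian f U V y q < hamiltonian f U V y q := by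
    obtain ⟨r, hr1, hr2⟩ := exists_between hlt
    obtain ⟨b, hb, H⟩ := hf.exists_lt_of_lt_hamiltonian hr2
    refine lt_of_lt_of_le (lt_sub_iff_add_lt.2 hr1) ((le_ciInf fun a : U => ?_).trans
      (le_ciSup hf.bddAbove_iInf_inner (⟨b, hb⟩ : V)))
    linarith [H a a.2, h a a.2 b hb]
  exact lt_irrefl _ h1

lemma RegularDynamics.hamiltonian_add_le (hf : RegularDynamics f U V C K) :
    hamiltonian f U V x (p + q) ≤ hamiltonian f U V x q + ‖p‖ * C :=
  hf.hamiltonian_le_add fun a ha b hb => by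
    rw [inner_add_left]
    linarith [(abs_le.1 (hf.abs_inner_le (p := p) (x := x) ha hb)).2]

lemma RegularDynamics.hamiltonian_le_space (hf : RegularDynamics f U V C K) :
    hamiltonian f U V x p ≤ hamiltonian f U V y p + ‖p‖ * (K * ‖x - y‖) :=
  hf.hamiltonian_le_add fun a ha b hb => by
    have h1 : inner ℝ p (f x a b) - inner ℝ p (f y a b) ≤ ‖p‖ * (K * ‖x - y‖) := by
      rw [← inner_sub_right]
      exact (real_inner_le_norm _ _).trans
        (mul_le_mul_of_nonneg_left (hf.lip x y a ha b hb) (norm_nonneg p))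
    linarith

end Hamiltonian

section Selection

variable {A B : Type*}
  [TopologicalSpace A] [MeasurableSpace A]
  [TopologicalSpace B] [T2Space B] [MeasurableSpace B] [BorelSpace B]

/-- A measurable, finitely valued selection: if every `b` in the compact set `V` has some `a ∈ U`
with `g a b < c`, then `a` can be chosen as a measurable function of `b`. -/
lemma exists_measurable_selection {U : Set A} {V : Set B} (hV : IsCompact V) (hU : U.Nonempty)
    {g : A → B → ℝ} (hg : ∀ a ∈ U, ContinuousOn (g a) V) {c : ℝ}
    (h : ∀ b ∈ V, ∃ a ∈ U, g a b < c) :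
    ∃ σ : B → A, Measurable σ ∧ (∀ b, σ b ∈ U) ∧ ∀ b ∈ V, g (σ b) b < c := by
  classical
  obtain ⟨a₀, ha₀⟩ := hU
  have : Nonempty A := ⟨a₀⟩
  choose! a ha hac using h
  have hmeas : ∀ b ∈ V, MeasurableSet {w | w ∈ V ∧ g (a b) w < c} := by
    intro b hb
    obtain ⟨O, hO, hOV⟩ := continuousOn_iff'.1 (hg (a b) (ha b hb)) (Iio c) isOpen_Iio
    have : {w | w ∈ V ∧ g (a b) w < c} = O ∩ V := by
      rw [← hOV]; ext w; simp [and_comm]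
    rw [this]
    exact hO.measurableSet.inter hV.measurableSet
  obtain ⟨s, hsV, hs⟩ := hV.elim_nhdsWithin_subcover (fun b => {w | g (a b) w < c}) (fun b hb =>
    (hg (a b) (ha b hb) b hb).eventually (Iio_mem_nhds (hac b hb)))
  have key : ∀ s : Finset B, (∀ b ∈ s, b ∈ V) → ∃ σ : B → A, Measurable σ ∧ (∀ b, σ b ∈ U) ∧
      ∀ w ∈ V, (∃ b ∈ s, g (a b) w < c) → g (σ w) w < c := by
    intro s
    induction s using Finset.induction_on with
    | empty => exact fun _ => ⟨fun _ => a₀, measurable_const, fun _ => ha₀, by simp⟩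
    | insert b s _ ih =>
      intro hs
      obtain ⟨σ, h1, h2, h3⟩ := ih fun b' hb' => hs b' (Finset.mem_insert_of_mem hb')
      have hb := hs b (Finset.mem_insert_self _ _)
      refine ⟨fun w => if w ∈ V ∧ g (a b) w < c then a b else σ w,
        Measurable.ite (hmeas b hb) measurable_const h1, fun w => ?_, fun w hw hex => ?_⟩
      · dsimp only
        split_ifs
        exacts [ha b hb, h2 w]
      · dsimp only
        split_ifs with hlt
        · exact hlt.2
        · obtain ⟨b', hb', hlt'⟩ := hex
          rcases Finset.mem_insert.1 hb' with rfl | hmem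
          · exact absurd ⟨hw, hlt'⟩ hlt
          · exact h3 w hw ⟨b', hmem, hlt'⟩
  obtain ⟨σ, h1, h2, h3⟩ := key s hsV
  refine ⟨σ, h1, h2, fun w hw => h3 w hw ?_⟩
  simpa using hs hw

end Selection

section TestFunctions

variable {n : ℕ} {x₀ : EuclideanSpace ℝ (Fin n)} {t₀ : ℝ}

/-! ### Test functions along trajectories -/

lemma eventually_forall_of_nhds {P : EuclideanSpace ℝ (Fin n) × ℝ → Prop} {C : ℝ} (hC : 0 ≤ C)
    (h : ∀ᶠ z in 𝓝 (x₀, t₀), P z) :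
    ∀ᶠ δ in 𝓝[>] (0 : ℝ), ∀ y, ‖y - x₀‖ ≤ C * δ → P (y, t₀ + δ) := by
  obtain ⟨r, hr, H⟩ := Metric.eventually_nhds_iff.1 h
  have h1 : ∀ᶠ δ in 𝓝[>] (0 : ℝ), δ < r / (C + 1) :=
    eventually_nhdsWithin_of_eventually_nhds (eventually_lt_nhds (by positivity))
  filter_upwards [h1, self_mem_nhdsWithin] with δ hδ hpos y hy
  have hpos' : 0 < δ := hpos
  rw [lt_div_iff₀ (by positivity)] at hδ
  refine H ?_
  rw [Prod.dist_eq, max_lt_iff, dist_eq_norm, dist_eq_norm]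
  constructor
  · refine hy.trans_lt ?_
    linarith
  · simp only [add_sub_cancel_left, Real.norm_eq_abs, abs_of_pos hpos']
    nlinarith

/-- Where `Φ - W` has a local maximum, `Φ` decreases along the directions in which the
linearization of `W` does. Only first-order information on `W` at the point is used, so that no
chain rule along merely absolutely continuous paths is needed. -/
lemma eventually_le_of_isLocalMax {Φ W : EuclideanSpace ℝ (Fin n) × ℝ → ℝ}
    {W' : EuclideanSpace ℝ (Fin n) × ℝ →L[ℝ] ℝ} (hW : HasFDerivAt W W' (x₀, t₀))
    (hmax : IsLocalMax (fun z => Φ z - W z) (x₀, t₀)) {C θ : ℝ} (hC : 0 ≤ C) (hθ : 0 < θ) :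
    ∀ᶠ δ in 𝓝[>] (0 : ℝ), ∀ y, ‖y - x₀‖ ≤ C * δ → W' (y - x₀, δ) ≤ -(2 * θ) * δ →
      Φ (y, t₀ + δ) ≤ Φ (x₀, t₀) - θ * δ := by
  have h1 := hW.isLittleO.def (show 0 < θ / (C + 1) by positivity)
  filter_upwards [eventually_forall_of_nhds hC h1, eventually_forall_of_nhds hC hmax,
    self_mem_nhdsWithin] with δ g1 g2 hpos y hy hle
  have hpos' : 0 < δ := hpos
  have e1 := g1 y hy
  have e2 := g2 y hy
  have e3 : (y, t₀ + δ) - (x₀, t₀) = (y - x₀, δ) := by simp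
  rw [e3] at e1
  have e4 : ‖(y - x₀, δ)‖ ≤ (C + 1) * δ := by
    rw [Prod.norm_mk, Real.norm_eq_abs, abs_of_pos hpos']
    refine max_le (by linarith) (by nlinarith)
  have e5 : θ / (C + 1) * ‖(y - x₀, δ)‖ ≤ θ * δ := by
    calc _ ≤ θ / (C + 1) * ((C + 1) * δ) := by gcongr
      _ = θ * δ := by field_simp
  have e6 := (abs_le.1 ((Real.norm_eq_abs _).symm.le.trans e1)).2
  linarith

variable {A B : Type*}
  [TopologicalSpace A] [SecondCountableTopology A] [T2Space A] [MeasurableSpace A] [BorelSpace A]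
  [TopologicalSpace B] [SecondCountableTopology B] [T2Space B] [MeasurableSpace B] [BorelSpace B]
  {f : EuclideanSpace ℝ (Fin n) → A → B → EuclideanSpace ℝ (Fin n)}
  {U : Set A} {V : Set B} {C K T c : ℝ} {p : EuclideanSpace ℝ (Fin n)}

lemma IsTrajectory.inner_sub_le (hf : RegularDynamics f U V C K) {t : ℝ} {u : ℝ → A} {v : ℝ → B}
    (hu : u ∈ Inputs U t T) (hv : v ∈ Inputs V t T)
    {x : EuclideanSpace ℝ (Fin n)} {ξ : ℝ → EuclideanSpace ℝ (Fin n)}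
    (hξ : IsTrajectory f t T x u v ξ) {τ : ℝ} (hτ : τ ∈ Icc t T)
    (hc : ∀ s ∈ Icc t T, inner ℝ p (f x (u s) (v s)) ≤ c) :
    inner ℝ p (ξ τ - x) ≤ (c + ‖p‖ * (K * (C * (τ - t)))) * (τ - t) := by
  have hK := hf.lip_nonneg
  have hC := hf.bound_nonneg
  have htT := hτ.1.trans hτ.2
  have hI : IntervalIntegrable (fun s => f (ξ s) (u s) (v s)) volume t τ := (hξ.mono hτ).2.1
  have h := hξ.sub_eq ⟨le_rfl, htT⟩ hτ
  rw [hξ.apply_left htT] at h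
  have h2 := (innerSL ℝ p).intervalIntegral_comp_comm hI
  simp only [innerSL_apply_apply] at h2
  rw [h, ← h2]
  have h3 : IntervalIntegrable (fun s => inner ℝ p (f (ξ s) (u s) (v s))) volume t τ :=
    ⟨(innerSL ℝ p).integrable_comp hI.1, (innerSL ℝ p).integrable_comp hI.2⟩
  calc ∫ s in t..τ, inner ℝ p (f (ξ s) (u s) (v s))
      ≤ ∫ _ in t..τ, (c + ‖p‖ * (K * (C * (τ - t)))) := by
        refine intervalIntegral.integral_mono_on hτ.1 h3 (by simp) fun s hs => ?_
        have hs' : s ∈ Icc t T := ⟨hs.1, hs.2.trans hτ.2⟩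
        have e1 : inner ℝ p (f (ξ s) (u s) (v s)) - inner ℝ p (f x (u s) (v s)) ≤
            ‖p‖ * (K * (C * (τ - t))) := by
          rw [← inner_sub_right]
          refine (real_inner_le_norm _ _).trans ?_
          gcongr
          refine (hf.lip _ _ _ (hu.2 s hs') _ (hv.2 s hs')).trans ?_
          gcongr
          refine (hξ.norm_sub_le_mul hf hu hv hs').trans ?_
          gcongr
          exact hs.2
        linarith [hc s hs']
    _ = _ := by rw [intervalIntegral.integral_const, smul_eq_mul, mul_comm]

end TestFunctions

section Viscosity

variable {n : ℕ} {A B : Type*}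
  [TopologicalSpace A] [SecondCountableTopology A] [T2Space A] [MeasurableSpace A] [BorelSpace A]
  [TopologicalSpace B] [SecondCountableTopology B] [T2Space B] [MeasurableSpace B] [BorelSpace B]
  {f : EuclideanSpace ℝ (Fin n) → A → B → EuclideanSpace ℝ (Fin n)}
  {U : Set A} {V : Set B} {C K D L T : ℝ} {l h : EuclideanSpace ℝ (Fin n) → ℝ}

/-! ### The value function is a viscosity solution -/

lemma deriv_snd_eq {W : EuclideanSpace ℝ (Fin n) × ℝ → ℝ} {x₀ : EuclideanSpace ℝ (Fin n)} {t₀ : ℝ}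
    {W' : EuclideanSpace ℝ (Fin n) × ℝ →L[ℝ] ℝ} (hW : HasFDerivAt W W' (x₀, t₀)) :
    deriv (fun t => W (x₀, t)) t₀ = W' (0, 1) := by
  have h1 : HasDerivAt (fun t : ℝ => (x₀, t)) ((0 : EuclideanSpace ℝ (Fin n)), (1 : ℝ)) t₀ :=
    (hasDerivAt_const t₀ x₀).prodMk (hasDerivAt_id t₀)
  exact (hW.comp_hasDerivAt t₀ h1).deriv

lemma inner_gradient_fst_eq {W : EuclideanSpace ℝ (Fin n) × ℝ → ℝ}
    {x₀ : EuclideanSpace ℝ (Fin n)} {t₀ : ℝ}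
    {W' : EuclideanSpace ℝ (Fin n) × ℝ →L[ℝ] ℝ} (hW : HasFDerivAt W W' (x₀, t₀))
    (q : EuclideanSpace ℝ (Fin n)) :
    inner ℝ (gradient (fun x => W (x, t₀)) x₀) q = W' (q, 0) := by
  have h1 : HasFDerivAt (fun x => W (x, t₀)) (W'.comp (ContinuousLinearMap.inl ℝ _ ℝ)) x₀ :=
    hW.comp x₀ (hasFDerivAt_prodMk_left x₀ t₀)
  rw [h1.hasGradientAt.gradient, InnerProductSpace.toDual_symm_apply]
  simp

/-- The value function is a viscosity solution. At a point where the Hamiltonian inequality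
fails for a test function, a measurable selection of controls (against a local maximum) or a
constant input of the second player (against a local minimum) contradicts the dynamic programming
principle over a short time. -/
theorem isViscositySolution_value (hf : RegularDynamics f U V C K) (hl : RegularCost l D L)
    (hh : RegularCost h D L) :
    IsViscositySolution (hamiltonian f U V) h T (value f U V l h T) := by
  refine ⟨continuousOn_value hf hl hh, fun W hW x₀ t₀ ht₀ => ?_⟩
  have hC := hf.bound_nonneg
  have hK := hf.lip_nonneg
  have hL := hh.lip_nonneg
  have hmem : univ ×ˢ Ioo 0 T ∈ 𝓝 (x₀, t₀) :=
    (isOpen_univ.prod isOpen_Ioo).mem_nhds ⟨mem_univ _, ht₀⟩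
  have hd : HasFDerivAt W (fderiv ℝ W (x₀, t₀)) (x₀, t₀) :=
    ((hW.contDiffAt hmem).differentiableAt (by simp)).hasFDerivAt
  set W' := fderiv ℝ W (x₀, t₀)
  set a := deriv (fun t => W (x₀, t)) t₀ with ha
  set p := gradient (fun x => W (x, t₀)) x₀ with hp
  have hW' : ∀ q s, W' (q, s) = inner ℝ p q + a * s := by
    intro q s
    rw [hp, inner_gradient_fst_eq hd, ha, deriv_snd_eq hd]
    have : ((q, s) : EuclideanSpace ℝ (Fin n) × ℝ) = (q, 0) + s • (0, 1) := by simp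
    rw [this, map_add, map_smul, smul_eq_mul, mul_comm]
  have hT : ∀ᶠ δ in 𝓝[>] (0 : ℝ), t₀ + δ ∈ Icc t₀ T := by
    have h1 : ∀ᶠ δ in 𝓝[>] (0 : ℝ), δ < T - t₀ :=
      eventually_nhdsWithin_of_eventually_nhds (eventually_lt_nhds (sub_pos.2 ht₀.2))
    filter_upwards [h1, self_mem_nhdsWithin] with δ g1 g2
    have : 0 < δ := g2
    constructor <;> linarith
  have hsmall : ∀ M ε : ℝ, 0 < ε → ∀ᶠ δ in 𝓝[>] (0 : ℝ), M * δ < ε := by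
    intro M ε hε
    have : Tendsto (fun δ : ℝ => M * δ) (𝓝 0) (𝓝 (M * 0)) := tendsto_id.const_mul M
    rw [mul_zero] at this
    exact eventually_nhdsWithin_of_eventually_nhds (this.eventually (gt_mem_nhds hε))
  constructor
  · intro hmax
    by_contra! hlt
    obtain ⟨hlt1, hlt2⟩ := max_lt_iff.1 hlt
    obtain ⟨c, hc1, hc2⟩ := exists_between
      (show hamiltonian f U V x₀ p < -a by linarith)
    obtain ⟨σ, hσm, hσU, hσ⟩ := exists_measurable_selection hf.isCompact_right hf.nonempty_left
      (g := fun a b => inner ℝ p (f x₀ a b)) (fun a ha => by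
        have h1 : ContinuousOn (fun b => f x₀ a b) V :=
          (hf.cont x₀).comp (f := fun b => (a, b)) (by fun_prop) fun b hb => ⟨ha, hb⟩
        exact continuousOn_const.inner h1) (fun b hb => hf.exists_lt_of_hamiltonian_lt hc1 hb)
    set θ := (-a - c) / 3 with hθ
    have hθ0 : 0 < θ := by rw [hθ]; linarith
    obtain ⟨δ, hδ, hδT, hδm, hδ1, hδ2⟩ :=
      ((eventually_mem_nhdsWithin (a := (0 : ℝ)) (s := Ioi 0)).and (hT.and
        ((eventually_le_of_isLocalMax hd hmax hC hθ0).and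
        ((hsmall (‖p‖ * (K * C)) θ hθ0).and (hsmall (L * C) _ (half_pos (neg_pos.2 hlt1))))))).exists
    have hδ0 : 0 < δ := hδ
    set v₀ := value f U V l h T (x₀, t₀) with hv₀
    let γ : Inputs V t₀ T → Inputs U t₀ T := fun v =>
      ⟨fun s => σ (v.1 s), hσm.comp_aemeasurable v.2.1, fun s _ => hσU _⟩
    have hγ : NonAnticipative γ := by
      intro s _ v v' hvv
      filter_upwards [hvv] with τ hτ
      simp only [γ, hτ]
    have := value_le_of_strategy (x := x₀) (c := v₀ - min (θ * δ) (-(h x₀ - v₀) / 2))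
      hf hl hh hδT hγ fun v => ?_
    · have h1 : 0 < min (θ * δ) (-(h x₀ - v₀) / 2) := by
        refine lt_min (by positivity) (by linarith)
      linarith
    · have hξ := hf.isTrajectory (hδT.1.trans hδT.2) (γ v).2 v.2 x₀
      set ξ := trajectory f t₀ T x₀ (γ v).1 v.1
      constructor
      · intro τ hτ
        have e1 := hξ.norm_sub_le_mul hf (γ v).2 v.2 (τ := τ) ⟨hτ.1, hτ.2.trans hδT.2⟩
        have e2 := (abs_le.1 (hh.lip (ξ τ) x₀)).2
        have e3 : L * ‖ξ τ - x₀‖ ≤ L * C * δ := by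
          rw [mul_assoc]
          refine mul_le_mul_of_nonneg_left (e1.trans ?_) hL
          gcongr
          linarith [hτ.2]
        have e4 := min_le_right (θ * δ) (-(h x₀ - v₀) / 2)
        linarith
      · have e1 := hξ.norm_sub_le_mul hf (γ v).2 v.2 hδT
        have e2 := hξ.inner_sub_le hf (p := p) (c := c) (γ v).2 v.2 hδT
          fun s hs => (hσ _ (v.2.2 s hs)).le
        rw [add_sub_cancel_left] at e1 e2
        refine (hδm _ e1 ?_).trans (sub_le_sub_left (min_le_left _ _) _)
        rw [hW']
        have e3 : (c + ‖p‖ * (K * (C * δ)) + a) * δ ≤ -(2 * θ) * δ := by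
          refine mul_le_mul_of_nonneg_right ?_ hδ0.le
          have : ‖p‖ * (K * (C * δ)) = ‖p‖ * (K * C) * δ := by ring
          rw [this]
          linarith
        linarith
  · intro hmin
    refine max_le (sub_nonpos.2 (le_value_obstacle hf hl hh ht₀.2.le)) ?_
    by_contra! hlt
    obtain ⟨c, hc1, hc2⟩ := exists_between
      (show -a < hamiltonian f U V x₀ p by linarith)
    obtain ⟨b, hb, hbc⟩ := hf.exists_lt_of_lt_hamiltonian hc2
    set θ := (a + c) / 3 with hθ
    have hθ0 : 0 < θ := by rw [hθ]; linarith
    have hmax : IsLocalMax (fun z => -value f U V l h T z - (-W) z) (x₀, t₀) := by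
      filter_upwards [hmin] with z hz
      simp only [Pi.neg_apply]
      linarith
    obtain ⟨δ, hδ, hδT, hδm, hδ1⟩ :=
      ((eventually_mem_nhdsWithin (a := (0 : ℝ)) (s := Ioi 0)).and (hT.and
        ((eventually_le_of_isLocalMax (Φ := fun z => -value f U V l h T z) hd.neg hmax hC hθ0).and
        (hsmall (‖p‖ * (K * C)) θ hθ0)))).exists
    have hδ0 : 0 < δ := hδ
    obtain ⟨γ, hγ, H⟩ := exists_strategy_forall_value_le (x := x₀)
      (c := value f U V l h T (x₀, t₀) + θ * δ / 2) hf hl hh hδT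
      (lt_add_of_pos_right _ (by positivity))
    let v : Inputs V t₀ T := ⟨fun _ => b, const_mem_inputs hb⟩
    have h1 := (H v).2
    have hξ := hf.isTrajectory (hδT.1.trans hδT.2) (γ v).2 v.2 x₀
    set ξ := trajectory f t₀ T x₀ (γ v).1 v.1
    have e1 := hξ.norm_sub_le_mul hf (γ v).2 v.2 hδT
    have e2 := hξ.inner_sub_le hf (p := -p) (c := -c) (γ v).2 v.2 hδT
      fun s hs => by
        rw [inner_neg_left]
        exact neg_le_neg (hbc _ ((γ v).2.2 s hs)).le
    rw [add_sub_cancel_left] at e1 e2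
    rw [norm_neg, inner_neg_left] at e2
    have e4 := hδm _ e1 ?_
    · have : 0 < θ * δ := by positivity
      linarith
    · rw [neg_apply, hW']
      have e3 : (-c + ‖p‖ * (K * (C * δ)) - a) * δ ≤ -(2 * θ) * δ := by
        refine mul_le_mul_of_nonneg_right ?_ hδ0.le
        have : ‖p‖ * (K * (C * δ)) = ‖p‖ * (K * C) * δ := by ring
        rw [this]
        linarith
      linarith

end Viscosity

/-! ### Comparison of viscosity solutions -/

/-- Doubling of variables on a compact set: as the weight `κ` of the penalty `P` grows, maximizers
of `A - κ P` accumulate at a maximum point of `A` on the diagonal, and `κ P` tends to `0` there. -/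
lemma exists_penalized_max {Z : Type*} [MetricSpace Z] {Q : Set Z} (hQ : IsCompact Q)
    (hne : Q.Nonempty) {A P : Z × Z → ℝ} (hA : ContinuousOn A (Q ×ˢ Q)) (hP : Continuous P)
    (hP₀ : ∀ z, 0 ≤ P z) (hPd : ∀ z, P (z, z) = 0) (hPe : ∀ z w, P (z, w) = 0 → z = w) :
    ∃ z₀ ∈ Q, (∀ d ∈ Q, A (d, d) ≤ A (z₀, z₀)) ∧ ∀ N ∈ 𝓝 z₀, ∀ ε > 0, ∃ κ > 0,
      ∃ z ∈ N ∩ Q, ∃ w ∈ N ∩ Q,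
        (∀ z' ∈ Q, ∀ w' ∈ Q, A (z', w') - κ * P (z', w') ≤ A (z, w) - κ * P (z, w)) ∧
        κ * P (z, w) < ε := by
  have hQQ := hQ.prod hQ
  have hex : ∀ k : ℕ, ∃ ζ ∈ Q ×ˢ Q, IsMaxOn (fun ζ => A ζ - (k + 1 : ℝ) * P ζ) (Q ×ˢ Q) ζ :=
    fun k => hQQ.exists_isMaxOn (hne.prod hne) (hA.sub (by fun_prop))
  choose ζ hζQ hζ using hex
  have hdiag : ∀ k : ℕ, ∀ d ∈ Q, (k + 1 : ℝ) * P (ζ k) ≤ A (ζ k) - A (d, d) := by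
    intro k d hd
    have h1 : A (d, d) - (k + 1 : ℝ) * P (d, d) ≤ A (ζ k) - (k + 1 : ℝ) * P (ζ k) :=
      hζ k (show (d, d) ∈ Q ×ˢ Q from ⟨hd, hd⟩)
    rw [hPd] at h1
    linarith
  have hdiag' : ∀ k : ℕ, ∀ d ∈ Q, A (d, d) ≤ A (ζ k) := by
    intro k d hd
    have h1 : 0 ≤ (k + 1 : ℝ) * P (ζ k) := mul_nonneg (by positivity) (hP₀ _)
    linarith [hdiag k d hd]
  obtain ⟨⟨z₀, w₀⟩, hzw, φ, hφ, hlim⟩ := hQQ.tendsto_subseq hζQ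
  have hAlim : Tendsto (fun k => A (ζ (φ k))) atTop (𝓝 (A (z₀, w₀))) :=
    (hA _ hzw).tendsto.comp
      (tendsto_nhdsWithin_iff.2 ⟨hlim, Eventually.of_forall fun k => hζQ _⟩)
  obtain ⟨d₀, hd₀⟩ := hne
  have hPlim0 : Tendsto (fun k => P (ζ (φ k))) atTop (𝓝 0) := by
    obtain ⟨M, hM⟩ := hQQ.bddAbove_image hA
    have h1 : Tendsto (fun k : ℕ => (M - A (d₀, d₀)) / ((φ k : ℝ) + 1)) atTop (𝓝 0) :=
      (tendsto_const_div_atTop_nhds_zero_nat (M - A (d₀, d₀)) |>.comp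
        (tendsto_add_atTop_nat 1 |>.comp hφ.tendsto_atTop)).congr fun k => by simp
    refine squeeze_zero (fun k => hP₀ _) (fun k => ?_) h1
    rw [le_div_iff₀ (by positivity), mul_comm]
    exact (hdiag _ d₀ hd₀).trans (sub_le_sub_right (hM (mem_image_of_mem _ (hζQ _))) _)
  have heq : z₀ = w₀ :=
    hPe _ _ (tendsto_nhds_unique ((hP.tendsto _).comp hlim) hPlim0)
  subst heq
  refine ⟨z₀, hzw.1, fun d hd => ge_of_tendsto' hAlim fun k => hdiag' _ d hd, fun N hN ε hε => ?_⟩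
  have hκP : Tendsto (fun k => ((φ k : ℝ) + 1) * P (ζ (φ k))) atTop (𝓝 0) := by
    have h1 : Tendsto (fun k => A (ζ (φ k)) - A (z₀, z₀)) atTop (𝓝 0) := by
      simpa using hAlim.sub_const (A (z₀, z₀))
    exact squeeze_zero (fun k => mul_nonneg (by positivity) (hP₀ _))
      (fun k => hdiag _ z₀ hzw.1) h1
  obtain ⟨k, hk1, hk2⟩ := ((hlim.eventually (prod_mem_nhds hN hN)).and
    (hκP.eventually (gt_mem_nhds hε))).exists
  refine ⟨(φ k : ℝ) + 1, by positivity, (ζ (φ k)).1, ⟨hk1.1, (hζQ _).1⟩, (ζ (φ k)).2,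
    ⟨hk1.2, (hζQ _).2⟩, fun z' hz' w' hw' => ?_, hk2⟩
  exact hζ (φ k) (show (z', w') ∈ Q ×ˢ Q from ⟨hz', hw'⟩)

section Barrier

variable {n : ℕ}

/-- The barrier that localizes the comparison argument near `(x, t)`: the first term is large away
from the cone of points that trajectories of speed at most `C` starting near `(x, t)` can reach,
the second one is large near time `0`. Both are small at `(x, t)` itself if `lam` is large. -/
noncomputable def barrier (lam C : ℝ) (x : EuclideanSpace ℝ (Fin n)) (t : ℝ)
    (z : EuclideanSpace ℝ (Fin n) × ℝ) : ℝ :=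
  Real.exp (lam * (√(1 + ‖z.1 - x‖ ^ 2) - C * z.2 - 2)) + Real.exp (lam * (t / 2 - z.2))

variable {lam C t : ℝ} {x : EuclideanSpace ℝ (Fin n)}

lemma contDiff_barrier : ContDiff ℝ ∞ (barrier lam C x t) := by
  have h1 : ContDiff ℝ ∞ fun z : EuclideanSpace ℝ (Fin n) × ℝ => √(1 + ‖z.1 - x‖ ^ 2) := by
    refine ContDiff.sqrt (contDiff_const.add ((contDiff_fst.sub contDiff_const).norm_sq ℝ)) ?_
    intro z
    positivity
  unfold barrier
  fun_prop

lemma hasDerivAt_barrier (y : EuclideanSpace ℝ (Fin n)) (s : ℝ) :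
    HasDerivAt (fun s => barrier lam C x t (y, s))
      (-(C * lam * Real.exp (lam * (√(1 + ‖y - x‖ ^ 2) - C * s - 2))) -
        lam * Real.exp (lam * (t / 2 - s))) s := by
  have h1 : HasDerivAt (fun s => lam * (√(1 + ‖y - x‖ ^ 2) - C * s - 2)) (lam * -(C * 1)) s :=
    ((((hasDerivAt_id s).const_mul C).const_sub _).sub_const _).const_mul lam
  have h2 : HasDerivAt (fun s => lam * (t / 2 - s)) (lam * -1) s :=
    ((hasDerivAt_id s).const_sub _).const_mul lam
  refine (h1.exp.add h2.exp).congr_deriv ?_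
  ring

lemma hasGradientAt_barrier (y : EuclideanSpace ℝ (Fin n)) (s : ℝ) :
    HasGradientAt (fun y => barrier lam C x t (y, s))
      ((lam * Real.exp (lam * (√(1 + ‖y - x‖ ^ 2) - C * s - 2)) / √(1 + ‖y - x‖ ^ 2)) •
        (y - x)) y := by
  rw [hasGradientAt_iff_hasFDerivAt]
  have h0 : HasFDerivAt (fun y : EuclideanSpace ℝ (Fin n) => 1 + ‖y - x‖ ^ 2) _ y :=
    (((hasFDerivAt_id y).sub_const x).norm_sq).const_add 1
  have h1 := ((((h0.sqrt (by positivity)).sub_const (C * s)).sub_const 2).const_mul lam).exp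
  refine (h1.add_const (Real.exp (lam * (t / 2 - s)))).congr_fderiv ?_
  ext q
  simp
  ring

lemma norm_gradient_barrier_le (hlam : 0 ≤ lam) (y : EuclideanSpace ℝ (Fin n)) (s : ℝ) :
    ‖(lam * Real.exp (lam * (√(1 + ‖y - x‖ ^ 2) - C * s - 2)) / √(1 + ‖y - x‖ ^ 2)) • (y - x)‖ ≤
      lam * Real.exp (lam * (√(1 + ‖y - x‖ ^ 2) - C * s - 2)) := by
  have h1 : ‖y - x‖ ≤ √(1 + ‖y - x‖ ^ 2) := Real.le_sqrt_of_sq_le (by linarith)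
  have h2 : 0 < √(1 + ‖y - x‖ ^ 2) := Real.sqrt_pos.2 (by positivity)
  rw [norm_smul, Real.norm_eq_abs, abs_of_nonneg (by positivity), div_mul_eq_mul_div,
    div_le_iff₀ h2]
  gcongr

end Barrier

section Comparison

variable {n : ℕ} {H : EuclideanSpace ℝ (Fin n) → EuclideanSpace ℝ (Fin n) → ℝ}
  {h : EuclideanSpace ℝ (Fin n) → ℝ} {C K L T : ℝ}
  {Φ₁ Φ₂ : EuclideanSpace ℝ (Fin n) × ℝ → ℝ}

lemma hasGradientAt_penalty (κ : ℝ) (x y : EuclideanSpace ℝ (Fin n)) :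
    HasGradientAt (fun x => κ * ‖x - y‖ ^ 2) ((2 * κ) • (x - y)) x := by
  rw [hasGradientAt_iff_hasFDerivAt]
  refine ((((hasFDerivAt_id x).sub_const y).norm_sq).const_mul κ).congr_fderiv ?_
  ext q
  simp
  ring

lemma hasDerivAt_penalty (κ t s : ℝ) :
    HasDerivAt (fun t => κ * (t - s) ^ 2) (2 * κ * (t - s)) t := by
  refine ((((hasDerivAt_id t).sub_const s).pow 2).const_mul κ).congr_deriv ?_
  simp
  ring

/-- Comparison in the interior of the time interval. If `Φ₁ - Φ₂` were positive at `(x₀, t₀)`, then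
doubling the variables would give test functions at two nearby points, touching `Φ₁` from above
and `Φ₂` from below; the barrier confines the points to the interior of a compact cylinder and
makes the difference of the two viscosity inequalities strict. No growth condition is needed,
because the speed of propagation is bounded by `C`. -/
lemma IsViscositySolution.le_of_mem_Ioo (hC : 0 ≤ C) (hK : 0 ≤ K) (hL : 0 ≤ L)
    (hHp : ∀ x p q, H x (p + q) ≤ H x q + ‖p‖ * C)
    (hHx : ∀ x y p, H x p ≤ H y p + ‖p‖ * (K * ‖x - y‖))
    (hh : ∀ x y, |h x - h y| ≤ L * ‖x - y‖)
    (hΦ₁ : IsViscositySolution H h T Φ₁) (hΦ₂ : IsViscositySolution H h T Φ₂)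
    (hT : ∀ x, Φ₁ (x, T) ≤ Φ₂ (x, T)) (x₀ : EuclideanSpace ℝ (Fin n)) {t₀ : ℝ}
    (ht₀ : t₀ ∈ Ioo 0 T) : Φ₁ (x₀, t₀) ≤ Φ₂ (x₀, t₀) := by
  by_contra! hlt
  have hT0 : 0 < T := ht₀.1.trans ht₀.2
  -- at distance `C * T + 3` the first exponent of the barrier is at least `lam` up to time `T`
  set R : ℝ := C * T + 3 with hR
  set Q : Set (EuclideanSpace ℝ (Fin n) × ℝ) := Metric.closedBall x₀ R ×ˢ Icc 0 T with hQ
  have hQc : IsCompact Q := (isCompact_closedBall x₀ R).prod isCompact_Icc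
  have hQs : Q ⊆ univ ×ˢ Icc 0 T := prod_mono (subset_univ _) le_rfl
  have hR0 : 0 ≤ R := by positivity
  have hz₀ : (x₀, t₀) ∈ Q := ⟨Metric.mem_closedBall_self hR0, ht₀.1.le, ht₀.2.le⟩
  have hc₁ : ContinuousOn Φ₁ Q := hΦ₁.1.mono hQs
  have hc₂ : ContinuousOn Φ₂ Q := hΦ₂.1.mono hQs
  obtain ⟨M, hM⟩ := hQc.bddAbove_image (hc₁.sub hc₂)
  have hM' : ∀ z ∈ Q, Φ₁ z - Φ₂ z ≤ M := fun z hz => hM (mem_image_of_mem _ hz)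
  -- `lam` is so large that the barrier is small at `(x₀, t₀)` and exceeds `M` on the sides
  have hlarge : ∀ c > 0, ∀ B, ∀ᶠ lam in atTop, B < Real.exp (lam * c) := fun c hc B =>
    (Real.tendsto_exp_atTop.comp (tendsto_id.atTop_mul_const hc)).eventually_gt_atTop B
  have hsmall : ∀ c > 0, ∀ ε > 0, ∀ᶠ lam in atTop, Real.exp (lam * -c) < ε := by
    intro c hc ε hε
    filter_upwards [hlarge c hc ε⁻¹] with lam hlam
    rw [mul_neg, Real.exp_neg]
    exact inv_lt_of_inv_lt₀ hε hlam
  set d := Φ₁ (x₀, t₀) - Φ₂ (x₀, t₀) with hd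
  have hd0 : 0 < d := sub_pos.2 hlt
  have ht2 : 0 < t₀ / 2 := half_pos ht₀.1
  obtain ⟨lam, hlam0, hl1, hl2, hl3, hl4⟩ := ((eventually_gt_atTop (0 : ℝ)).and
    ((hlarge 1 one_pos M).and ((hlarge _ ht2 M).and ((hsmall 1 one_pos (d / 4) (by positivity)).and
      (hsmall _ ht2 (d / 4) (by positivity)))))).exists
  set ψ := barrier lam C x₀ t₀ with hψ
  have hψpos : ∀ z, 0 ≤ ψ z := fun z => by rw [hψ]; unfold barrier; positivity
  have hψ₀ : ψ (x₀, t₀) ≤ d / 2 := by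
    have h1 : Real.exp (lam * (√(1 + ‖x₀ - x₀‖ ^ 2) - C * t₀ - 2)) ≤ Real.exp (lam * -1) := by
      have := mul_nonneg hC ht₀.1.le
      gcongr
      simp
      linarith
    have h2 : t₀ / 2 - t₀ = -(t₀ / 2) := by ring
    rw [hψ, barrier, h2]
    linarith
  set A : (EuclideanSpace ℝ (Fin n) × ℝ) × (EuclideanSpace ℝ (Fin n) × ℝ) → ℝ :=
    fun ζ => Φ₁ ζ.1 - ψ ζ.1 - Φ₂ ζ.2 with hA
  set P : (EuclideanSpace ℝ (Fin n) × ℝ) × (EuclideanSpace ℝ (Fin n) × ℝ) → ℝ :=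
    fun ζ => ‖ζ.1.1 - ζ.2.1‖ ^ 2 + (ζ.1.2 - ζ.2.2) ^ 2 with hP
  have hAc : ContinuousOn A (Q ×ˢ Q) := by
    have h1 : ContinuousOn ψ Q := (contDiff_barrier).continuous.continuousOn
    exact ((hc₁.sub h1).comp continuousOn_fst fun ζ hζ => hζ.1).sub
      (hc₂.comp continuousOn_snd fun ζ hζ => hζ.2)
  obtain ⟨⟨x', t'⟩, hz', hmax, hdbl⟩ := exists_penalized_max hQc ⟨_, hz₀⟩ hAc (P := P) (by fun_prop)
    (fun z => by positivity) (fun z => by simp [hP]) (fun z w hzw => by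
      have h1 : ‖z.1 - w.1‖ ^ 2 = 0 := by
        have : ‖z.1 - w.1‖ ^ 2 + (z.2 - w.2) ^ 2 = 0 := hzw
        linarith [sq_nonneg (z.2 - w.2), sq_nonneg ‖z.1 - w.1‖]
      have h2 : (z.2 - w.2) ^ 2 = 0 := by
        have : ‖z.1 - w.1‖ ^ 2 + (z.2 - w.2) ^ 2 = 0 := hzw
        linarith [sq_nonneg (z.2 - w.2), sq_nonneg ‖z.1 - w.1‖]
      exact Prod.ext (sub_eq_zero.1 (norm_eq_zero.1 (pow_eq_zero_iff two_ne_zero |>.1 h1)))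
        (sub_eq_zero.1 (pow_eq_zero_iff two_ne_zero |>.1 h2)))
  have hA₀ : d / 2 ≤ A ((x₀, t₀), (x₀, t₀)) := by
    simp only [hA]
    linarith
  have hAz : d / 2 ≤ Φ₁ (x', t') - ψ (x', t') - Φ₂ (x', t') := hA₀.trans (hmax _ hz₀)
  have hMz : Φ₁ (x', t') - Φ₂ (x', t') ≤ M := hM' _ hz'
  have hψM : ψ (x', t') < M := by linarith
  have e1 : 0 < Real.exp (lam * (√(1 + ‖x' - x₀‖ ^ 2) - C * t' - 2)) := Real.exp_pos _
  have e2 : 0 < Real.exp (lam * (t₀ / 2 - t')) := Real.exp_pos _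
  rw [hψ, barrier] at hψM
  have hx' : x' ∈ Metric.ball x₀ R := by
    rw [mem_ball_iff_norm]
    by_contra! hge
    have h1 : ‖x' - x₀‖ ≤ √(1 + ‖x' - x₀‖ ^ 2) := Real.le_sqrt_of_sq_le (by linarith)
    have h2 : C * t' ≤ C * T := mul_le_mul_of_nonneg_left hz'.2.2 hC
    have h3 : Real.exp (lam * 1) ≤ Real.exp (lam * (√(1 + ‖x' - x₀‖ ^ 2) - C * t' - 2)) := by
      gcongr
      linarith
    linarith
  have ht' : t' ∈ Ioo 0 T := by
    refine ⟨lt_of_le_of_ne hz'.2.1 ?_, lt_of_le_of_ne hz'.2.2 ?_⟩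
    · intro h0
      have h1 : t₀ / 2 - t' = t₀ / 2 := by rw [← h0, sub_zero]
      dsimp only at hψM
      rw [h1] at hψM
      linarith
    · intro h0
      rw [h0] at hAz
      linarith [hT x', hψpos (x', T)]
  have hint : Metric.ball x₀ R ×ˢ Ioo 0 T ⊆ Q :=
    prod_mono Metric.ball_subset_closedBall Ioo_subset_Icc_self
  have hopen : IsOpen (Metric.ball x₀ R ×ˢ Ioo 0 T) := Metric.isOpen_ball.prod isOpen_Ioo
  obtain ⟨r, hr, hLr⟩ : ∃ r > 0, L * (2 * r) < d / 2 := by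
    refine ⟨d / (8 * (L + 1)), by positivity, ?_⟩
    have : L * (2 * (d / (8 * (L + 1)))) = L / (L + 1) * (d / 4) := by field_simp; ring
    rw [this]
    have h1 : L / (L + 1) ≤ 1 := by rw [div_le_one (by positivity)]; linarith
    nlinarith
  obtain ⟨κ, hκ, ⟨x, t⟩, ⟨⟨hzN, hzr⟩, hzQ⟩, ⟨y, s⟩, ⟨⟨hwN, hwr⟩, hwQ⟩, hkmax, hκP⟩ :=
    hdbl ((Metric.ball x₀ R ×ˢ Ioo 0 T) ∩ Metric.ball (x', t') r)
      (inter_mem (hopen.mem_nhds ⟨hx', ht'⟩) (Metric.ball_mem_nhds _ hr))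
      (lam * Real.exp (-(lam * T)) / (2 * (K + 1))) (by positivity)
  have hAxy : d / 2 ≤ Φ₁ (x, t) - ψ (x, t) - Φ₂ (y, s) := by
    have h1 := hkmax _ hz₀ _ hz₀
    have h2 : P ((x₀, t₀), (x₀, t₀)) = 0 := by simp [hP]
    have h3 : 0 ≤ κ * P ((x, t), (y, s)) := by positivity
    rw [h2] at h1
    have h4 : A ((x, t), (y, s)) = Φ₁ (x, t) - ψ (x, t) - Φ₂ (y, s) := rfl
    linarith
  -- each viscosity inequality is tested with the other pair of variables frozen; the penalty
  -- contributes the same time derivative and the same gradient to both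
  have hsub := (hΦ₁.2 (fun z => ψ z + κ * ‖z.1 - y‖ ^ 2 + κ * (z.2 - s) ^ 2)
    (ContDiff.contDiffOn (by
      have h1 : ContDiff ℝ ∞ ψ := contDiff_barrier
      have h2 : ContDiff ℝ ∞ fun z : EuclideanSpace ℝ (Fin n) × ℝ => ‖z.1 - y‖ ^ 2 :=
        (contDiff_fst.sub contDiff_const).norm_sq ℝ
      fun_prop)) x t hzN.2).1 (by
      filter_upwards [hopen.mem_nhds hzN] with z hz
      have := hkmax z (hint hz) _ hwQ
      simp only [hA, hP] at this
      linarith)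
  have hsup := (hΦ₂.2 (fun z => -(κ * ‖z.1 - x‖ ^ 2) - κ * (z.2 - t) ^ 2)
    (ContDiff.contDiffOn (by
      have h2 : ContDiff ℝ ∞ fun z : EuclideanSpace ℝ (Fin n) × ℝ => ‖z.1 - x‖ ^ 2 :=
        (contDiff_fst.sub contDiff_const).norm_sq ℝ
      fun_prop)) y s hwN.2).2 (by
      filter_upwards [hopen.mem_nhds hwN] with z hz
      have := hkmax _ hzQ z (hint hz)
      simp only [hA, hP] at this
      have h1 := norm_sub_rev x z.1
      have h2 := norm_sub_rev x y
      rw [h1, h2] at this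
      linarith [sub_sq_comm t z.2, sub_sq_comm t s])
  set E₁ := Real.exp (lam * (√(1 + ‖x - x₀‖ ^ 2) - C * t - 2)) with hE₁
  set E₂ := Real.exp (lam * (t₀ / 2 - t)) with hE₂
  set g := (lam * E₁ / √(1 + ‖x - x₀‖ ^ 2)) • (x - x₀) with hg
  have hg1 : ‖g‖ ≤ lam * E₁ := norm_gradient_barrier_le hlam0.le x t
  have hdt : deriv (fun t => ψ (x, t) + κ * ‖x - y‖ ^ 2 + κ * (t - s) ^ 2) t =
      -(C * lam * E₁) - lam * E₂ + 2 * κ * (t - s) :=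
    (((hasDerivAt_barrier x t).add_const _).add (hasDerivAt_penalty κ t s)).deriv
  have hds : deriv (fun s => -(κ * ‖y - x‖ ^ 2) - κ * (s - t) ^ 2) s = 2 * κ * (t - s) := by
    rw [((hasDerivAt_penalty κ s t).const_sub _).deriv]
    ring
  have hgx : gradient (fun x => ψ (x, t) + κ * ‖x - y‖ ^ 2 + κ * (t - s) ^ 2) x =
      g + (2 * κ) • (x - y) := by
    refine HasGradientAt.gradient ?_
    rw [hasGradientAt_iff_hasFDerivAt, map_add]
    exact ((hasGradientAt_barrier x t).hasFDerivAt.add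
      (hasGradientAt_penalty κ x y).hasFDerivAt).add_const _
  have hgy : gradient (fun y => -(κ * ‖y - x‖ ^ 2) - κ * (s - t) ^ 2) y =
      (2 * κ) • (x - y) := by
    refine HasGradientAt.gradient ?_
    rw [hasGradientAt_iff_hasFDerivAt, ← neg_sub y x, smul_neg, map_neg]
    exact ((hasGradientAt_penalty κ y x).hasFDerivAt.neg).sub_const _
  simp only at hsub hsup
  rw [hdt, hgx] at hsub
  rw [hds, hgy] at hsup
  have hsup1 := (le_max_left _ _).trans hsup
  have hsup2 := (le_max_right _ _).trans hsup
  rcases le_max_iff.1 hsub with hcase | hcase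
  -- either `Φ₁` touches the obstacle and `Φ₁ (x, t) - Φ₂ (y, s) ≤ h x - h y` is too small, or the
  -- two Hamiltonian inequalities contradict the strict decrease of the barrier in time
  · have h1 := (abs_le.1 (hh x y)).2
    have h2 : ‖x - y‖ ≤ 2 * r := by
      rw [Metric.mem_ball, Prod.dist_eq, max_lt_iff] at hzr hwr
      rw [← dist_eq_norm]
      linarith [dist_triangle_right x y x', hzr.1, hwr.1]
    have h3 := mul_le_mul_of_nonneg_left h2 hL
    linarith [hψpos (x, t)]
  · have h1 := hHp x g ((2 * κ) • (x - y))
    have h2 := hHx x y ((2 * κ) • (x - y))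
    have h3 : ‖g‖ * C ≤ lam * E₁ * C := mul_le_mul_of_nonneg_right hg1 hC
    have h4 : ‖(2 * κ) • (x - y)‖ * (K * ‖x - y‖) = 2 * K * (κ * ‖x - y‖ ^ 2) := by
      rw [norm_smul, Real.norm_eq_abs, abs_of_pos (by positivity)]
      ring
    have h5 : κ * ‖x - y‖ ^ 2 < lam * Real.exp (-(lam * T)) / (2 * (K + 1)) := by
      refine lt_of_le_of_lt ?_ hκP
      refine mul_le_mul_of_nonneg_left ?_ hκ.le
      simp only [hP]
      linarith [sq_nonneg (t - s)]
    have h6 : 2 * (K + 1) * (κ * ‖x - y‖ ^ 2) < lam * Real.exp (-(lam * T)) := by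
      rwa [lt_div_iff₀ (by positivity), mul_comm] at h5
    have h7 : Real.exp (-(lam * T)) ≤ E₂ := by
      rw [hE₂, ← mul_neg]
      gcongr
      linarith [hzN.2.2]
    have h8 := mul_le_mul_of_nonneg_left h7 hlam0.le
    have h9 : 0 ≤ κ * ‖x - y‖ ^ 2 := by positivity
    linarith

theorem IsViscositySolution.le (hC : 0 ≤ C) (hK : 0 ≤ K) (hL : 0 ≤ L)
    (hHp : ∀ x p q, H x (p + q) ≤ H x q + ‖p‖ * C)
    (hHx : ∀ x y p, H x p ≤ H y p + ‖p‖ * (K * ‖x - y‖))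
    (hh : ∀ x y, |h x - h y| ≤ L * ‖x - y‖)
    (hΦ₁ : IsViscositySolution H h T Φ₁) (hΦ₂ : IsViscositySolution H h T Φ₂)
    (hT : ∀ x, Φ₁ (x, T) ≤ Φ₂ (x, T)) (x : EuclideanSpace ℝ (Fin n)) {t : ℝ}
    (ht : t ∈ Icc 0 T) : Φ₁ (x, t) ≤ Φ₂ (x, t) := by
  rcases ht.2.eq_or_lt with rfl | htT
  · exact hT x
  have hc : ∀ Φ : EuclideanSpace ℝ (Fin n) × ℝ → ℝ, ContinuousOn Φ (univ ×ˢ Icc 0 T) →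
      ContinuousWithinAt (fun s => Φ (x, s)) (Ioo 0 T) t := fun Φ hΦ =>
    ((hΦ.comp (by fun_prop : ContinuousOn (fun s : ℝ => (x, s)) (Icc 0 T))
      fun s hs => ⟨mem_univ _, hs⟩) t ht).mono Ioo_subset_Icc_self
  have hcl : t ∈ closure (Ioo 0 T) := by
    rwa [closure_Ioo (ht.1.trans_lt htT).ne]
  exact ContinuousWithinAt.closure_le (f := fun s => Φ₁ (x, s)) (g := fun s => Φ₂ (x, s)) hcl
    (hc _ hΦ₁.1) (hc _ hΦ₂.1) fun s hs => hΦ₁.le_of_mem_Ioo hC hK hL hHp hHx hh hΦ₂ hT x hs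

end Comparison

/-! ### The augmented system -/

section Augmented

variable {n : ℕ} {A B : Type*} [TopologicalSpace A] [TopologicalSpace B]
  {f : EuclideanSpace ℝ (Fin n) → A → B → EuclideanSpace ℝ (Fin n)}
  {U : Set A} {V : Set B} {C K : ℝ}

lemma RegularDynamics.augmented (hf : RegularDynamics f U V C K) :
    RegularDynamics (augmented f) (U ×ˢ Icc (0 : ℝ) 1) V C K where
  isCompact_left := hf.isCompact_left.prod isCompact_Icc
  nonempty_left := hf.nonempty_left.prod ⟨0, by simp⟩
  isCompact_right := hf.isCompact_right
  nonempty_right := hf.nonempty_right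
  bound_nonneg := hf.bound_nonneg
  lip_nonneg := hf.lip_nonneg
  bound := by
    rintro x ⟨a, r⟩ ⟨ha, hr⟩ b hb
    change ‖r • f x a b‖ ≤ C
    rw [norm_smul, Real.norm_eq_abs, abs_of_nonneg hr.1]
    exact (mul_le_of_le_one_left (norm_nonneg _) hr.2).trans (hf.bound x a ha b hb)
  lip := by
    rintro x y ⟨a, r⟩ ⟨ha, hr⟩ b hb
    change ‖r • f x a b - r • f y a b‖ ≤ _
    rw [← smul_sub, norm_smul, Real.norm_eq_abs, abs_of_nonneg hr.1]
    exact (mul_le_of_le_one_left (norm_nonneg _) hr.2).trans (hf.lip x y a ha b hb)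
  cont x := by
    have h1 : ContinuousOn (fun w : (A × ℝ) × B => f x w.1.1 w.2) ((U ×ˢ Icc (0 : ℝ) 1) ×ˢ V) :=
      (hf.cont x).comp (f := fun w : (A × ℝ) × B => (w.1.1, w.2)) (by fun_prop)
        fun w hw => ⟨hw.1.1, hw.2⟩
    have h2 : ContinuousOn (fun w : (A × ℝ) × B => w.1.2) ((U ×ˢ Icc (0 : ℝ) 1) ×ˢ V) := by
      fun_prop
    exact h2.smul h1

/-- The multiplier `0` lets the first player freeze the state, so that the Hamiltonian of the
augmented system is truncated at `0`. -/
lemma RegularDynamics.hamiltonian_augmented (hf : RegularDynamics f U V C K)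
    (x p : EuclideanSpace ℝ (Fin n)) :
    hamiltonian (ReachAvoid.augmented f) (U ×ˢ Icc (0 : ℝ) 1) V x p =
      min 0 (hamiltonian f U V x p) := by
  have hg := hf.augmented
  have hinner : ∀ (w : A × ℝ) b, inner ℝ p (ReachAvoid.augmented f x w b) =
      w.2 * inner ℝ p (f x w.1 b) := fun w b => real_inner_smul_right _ _ _
  obtain ⟨a, ha⟩ := hf.nonempty_left
  refine eq_of_forall_lt_iff fun c => ?_
  constructor
  · intro hc
    obtain ⟨c', h1, h2⟩ := exists_between hc
    obtain ⟨b, hb, H⟩ := hg.exists_lt_of_lt_hamiltonian h2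
    refine lt_min ?_ (h1.trans_le ?_)
    · have := H (a, 0) ⟨ha, by simp⟩
      rw [hinner, zero_mul] at this
      exact h1.trans this
    · by_contra! hlt
      obtain ⟨a', ha', hlt'⟩ := hf.exists_lt_of_hamiltonian_lt hlt hb
      have := H (a', 1) ⟨ha', by simp⟩
      rw [hinner, one_mul] at this
      exact lt_asymm this hlt'
  · intro hc
    obtain ⟨hc0, hcH⟩ := lt_min_iff.1 hc
    obtain ⟨c', h1, h2⟩ := exists_between (lt_min hc0 hcH)
    obtain ⟨h3, h4⟩ := lt_min_iff.1 h2
    obtain ⟨b, hb, H⟩ := hf.exists_lt_of_lt_hamiltonian h4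
    refine h1.trans_le ?_
    by_contra! hlt
    obtain ⟨⟨a', r⟩, ⟨ha', hr⟩, hlt'⟩ := hg.exists_lt_of_hamiltonian_lt hlt hb
    rw [hinner] at hlt'
    have h5 := H a' ha'
    -- `c' = r * c' + (1 - r) * c' ≤ r * ⟪p, f x a' b⟫` since `c' < 0` and `r ∈ [0, 1]`
    have h6 := mul_le_mul_of_nonneg_left h5.le hr.1
    have h7 := mul_nonneg (sub_nonneg.2 hr.2) (neg_nonneg.2 h3.le)
    simp only at hlt'
    linarith

end Augmented

end ReachAvoid

theorem theorem2 (n m p : ℕ) (T : ℝ) (hT : 0 ≤ T)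
    (U : Set (EuclideanSpace ℝ (Fin m))) (V : Set (EuclideanSpace ℝ (Fin p)))
    (hU : IsCompact U) (hU_ne : U.Nonempty) (hV : IsCompact V) (hV_ne : V.Nonempty)
    (f : EuclideanSpace ℝ (Fin n) → EuclideanSpace ℝ (Fin m) → EuclideanSpace ℝ (Fin p) →
      EuclideanSpace ℝ (Fin n))
    (l h : EuclideanSpace ℝ (Fin n) → ℝ)
    (hf_bdd : ∃ C : ℝ, ∀ x, ∀ u ∈ U, ∀ v ∈ V, ‖f x u v‖ ≤ C)
    (hf_lip : ∃ C : ℝ, ∀ x y, ∀ u ∈ U, ∀ v ∈ V, ‖f x u v - f y u v‖ ≤ C * ‖x - y‖)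
    (hf_cont : ∀ x, ContinuousOn
      (fun w : EuclideanSpace ℝ (Fin m) × EuclideanSpace ℝ (Fin p) => f x w.1 w.2) (U ×ˢ V))
    (hl_bdd : ∃ C : ℝ, ∀ x, |l x| ≤ C) (hl_lip : ∃ C : ℝ, ∀ x y, |l x - l y| ≤ C * ‖x - y‖)
    (hh_bdd : ∃ C : ℝ, ∀ x, |h x| ≤ C) (hh_lip : ∃ C : ℝ, ∀ x y, |h x - h y| ≤ C * ‖x - y‖) :
    (ReachAvoid.IsViscositySolution (fun x q => min 0 (ReachAvoid.hamiltonian f U V x q)) h T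
        (ReachAvoid.reachValue f U V l h T) ∧
      ∀ x, ReachAvoid.reachValue f U V l h T (x, T) = max (l x) (h x)) ∧
    ∀ Φ : EuclideanSpace ℝ (Fin n) × ℝ → ℝ,
      ReachAvoid.IsViscositySolution (fun x q => min 0 (ReachAvoid.hamiltonian f U V x q)) h T Φ →
      (∀ x, Φ (x, T) = max (l x) (h x)) →
      ∀ x, ∀ t ∈ Set.Icc 0 T, Φ (x, t) = ReachAvoid.reachValue f U V l h T (x, t) := by
  obtain ⟨C, hC⟩ := hf_bdd
  obtain ⟨K, hK⟩ := hf_lip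
  obtain ⟨D₁, hD₁⟩ := hl_bdd
  obtain ⟨L₁, hL₁⟩ := hl_lip
  obtain ⟨D₂, hD₂⟩ := hh_bdd
  obtain ⟨L₂, hL₂⟩ := hh_lip
  obtain ⟨a, ha⟩ := hU_ne
  obtain ⟨b, hb⟩ := hV_ne
  have hf : ReachAvoid.RegularDynamics f U V C (max K 0) :=
    { isCompact_left := hU
      nonempty_left := ⟨a, ha⟩
      isCompact_right := hV
      nonempty_right := ⟨b, hb⟩
      bound_nonneg := (norm_nonneg _).trans (hC 0 a ha b hb)
      lip_nonneg := le_max_right _ _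
      bound := hC
      lip := fun x y u hu v hv => (hK x y u hu v hv).trans
        (mul_le_mul_of_nonneg_right (le_max_left _ _) (norm_nonneg _))
      cont := hf_cont }
  have hl : ReachAvoid.RegularCost l (max D₁ D₂) (max 0 (max L₁ L₂)) :=
    ⟨le_max_left _ _, fun x => (hD₁ x).trans (le_max_left _ _), fun x y => (hL₁ x y).trans
      (mul_le_mul_of_nonneg_right ((le_max_left _ _).trans (le_max_right _ _)) (norm_nonneg _))⟩
  have hh : ReachAvoid.RegularCost h (max D₁ D₂) (max 0 (max L₁ L₂)) :=
    ⟨le_max_left _ _, fun x => (hD₂ x).trans (le_max_right _ _), fun x y => (hL₂ x y).trans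
      (mul_le_mul_of_nonneg_right ((le_max_right _ _).trans (le_max_right _ _)) (norm_nonneg _))⟩
  have hg := hf.augmented
  have hH : (fun x q => min 0 (ReachAvoid.hamiltonian f U V x q)) =
      ReachAvoid.hamiltonian (ReachAvoid.augmented f) (U ×ˢ Icc (0 : ℝ) 1) V := by
    funext x q
    exact (hf.hamiltonian_augmented x q).symm
  rw [hH]
  have hsol : ReachAvoid.IsViscositySolution
      (ReachAvoid.hamiltonian (ReachAvoid.augmented f) (U ×ˢ Icc (0 : ℝ) 1) V) h T
      (ReachAvoid.reachValue f U V l h T) :=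
    ReachAvoid.isViscositySolution_value hg hl hh
  have hterm : ∀ x, ReachAvoid.reachValue f U V l h T (x, T) = max (l x) (h x) :=
    fun x => ReachAvoid.value_terminal hg hl hh
  refine ⟨⟨hsol, hterm⟩, fun Φ hΦ hΦT x t ht => le_antisymm ?_ ?_⟩
  · exact hΦ.le hg.bound_nonneg hg.lip_nonneg hh.lip_nonneg (fun _ _ _ => hg.hamiltonian_add_le)
      (fun _ _ _ => hg.hamiltonian_le_space) hh.lip hsol
      (fun x => ((hΦT x).trans (hterm x).symm).le) x ht
  · exact hsol.le hg.bound_nonneg hg.lip_nonneg hh.lip_nonneg (fun _ _ _ => hg.hamiltonian_add_le)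
      (fun _ _ _ => hg.hamiltonian_le_space) hh.lip hΦ
      (fun x => ((hterm x).trans (hΦT x).symm).le) x ht
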